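/- **Setting.** Let $(\Lambda,\Sigma,\Lambda^\vee,\Sigma^\vee)$ be the root datum of a connected complex reductive group $G$ with a maximal torus ($\Lambda$ is the character lattice), with a choice of simple roots $\alpha_1,\dots,\alpha_n$, positive roots $\Sigma^+$, negative roots $\Sigma^-=-\Sigma^+$, Weyl group $W$, length $\ell$, Bruhat order $\le$ and longest element $w_0$. Put $R=\mathbb Z[q^{1/2},q^{-1/2}]$, $S=R[\Lambda]$, $Q=\operatorname{Frac}(S)$; $W$ acts on $Q$ by $w(e^\lambda)=e^{w\lambda}$. Write $q_w=q^{\ell(w)}$ and, for roots $\alpha$, $$x_\alpha=1-e^{-\alpha},\quad \tilde x_\alpha=q-e^\alpha,\quad \hat x_\alpha=1-qe^{-\alpha},\qquad \Sigma_w=w\Sigma^-\cap\Sigma^+,\quad x_{-w}=\prod_{\beta\in\Sigma_w}x_{-\beta},\quad \hat x_w=\prod_{\beta\in\Sigma_w}\hat x_\beta .$$ Let $Q_W$ be the twisted group algebra, with left $Q$-basis $\{\delta_w\}_{w\in W}$ and product $p\delta_u\cdot p'\delta_v=p\,u(p')\,\delta_{uv}$. Let $Q_W^*=\operatorname{Hom}_Q(Q_W,Q)=\operatorname{Hom}(W,Q)$,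 a $Q$-vector space with basis $\{f_w\}$, $f_w(\delta_v)=\delta_{w,v}$. The algebra $Q_W$ acts on $Q_W^*$ by $(z\bullet f)(z')=f(z'z)$, and for $F=\sum_v c_vf_v\in Q_W^*$ we write $F|_v=c_v$. Put $$Y_\alpha=\frac1{x_{-\alpha}}+\frac1{x_\alpha}\delta_{s_\alpha},\qquad \tau^+_\alpha=\tilde x_\alpha Y_\alpha-1,\qquad \tau^-_\alpha=\hat x_\alpha Y_{-\alpha}-1,$$ and $\tau^\pm_w=\tau^\pm_{\alpha_{i_1}}\cdots\tau^\pm_{\alpha_{i_k}}$ for a reduced decomposition $w=s_{i_1}\cdots s_{i_k}$. Write $\tau^+_w=\sum_v a^+_{w,v}\delta_v$ and $\delta_w=\sum_v b^-_{w,v}\tau^-_v$, and let $\{\tau^{-*}_w\}$ be the basis of $Q_W^*$ dual to $\{\tau^-_w\}$. Define $$\mathrm{St}^+_w=\tau^+_{w^{-1}}\bullet(x_{-w_0}f_e),\qquad \mathrm{St}^-_w=(\tau^-_{w_0w})^{-1}\bullet(x_{-w_0}f_{w_0}).$$ The root polynomial of a reduced decomposition $w=s_{i_1}\cdots s_{i_l}$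 is $$\mathcal R^{\tau^\pm}_w=\prod_{j=1}^{l}\Bigl(1\otimes\tau^\pm_{\alpha_{i_j}}-\frac{q-1}{x_{-\beta_j}}\otimes 1\Bigr)\in Q\otimes_R Q_W,\qquad \beta_j=s_{i_1}\cdots s_{i_{j-1}}\alpha_{i_j},$$ the factors being multiplied from left ($j=1$) to right ($j=l$). **Theorem.** 0. The elements $\tau^\pm_w$ do not depend on the reduced decomposition, the $\tau^-_w$ are invertible in $Q_W$, and $\{\tau^-_w\}_{w\in W}$ is a $Q$-basis of $Q_W$. There is a unique family $K^\tau_{v,w}\in Q$ $(v,w\in W)$, with $K^\tau_{v,w}=0$ unless $v\le w$, such that $\mathcal R^{\tau^\pm}_w=\sum_{v\le w}K^\tau_{v,w}\otimes\tau^\pm_v$ for both signs, every $w\in W$ and every reduced decomposition of $w$. 1. For every $w\in W$, $$\mathrm{St}^+_w=\sum_{v\le w}v\bigl(a^+_{w^{-1},v^{-1}}\bigr)\,x_{-w_0}\,f_v .$$ 2. For every $w\in W$, $$q_{w_0w}\mathrm{St}^-_w=\hat x_{w_0}\tau^{-*}_w=\sum_{v\ge w}\hat x_{w_0}b^-_{v,w}f_v=\sum_{v\ge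 w}\frac{\hat x_{w_0}x_{-v}}{\hat x_v}K^\tau_{w,v}f_v=\sum_{v\ge w}v\bigl(\hat x_{v^{-1}w_0}\bigr)x_{-v}K^\tau_{w,v}f_v .$$ 3. Consequently, for the algebraic models $\mathrm{stab}_+(w):=q_w^{-1/2}\,\mathrm{St}^+_w$ and $\mathrm{stab}_-(w):=q_{w_0}q_w^{-1/2}\,\mathrm{St}^-_w$ in $Q_W^*$ of the K-theoretic stable bases of $T^*G/B$ (that these elements are the geometric stable bases is a separate theorem, which is not part of this one), for all $w,v\in W$, $$\mathrm{stab}_+(w)|_v=q^{-\ell(w)/2}\,v\bigl(a^+_{w^{-1},v^{-1}}\bigr)\prod_{\alpha>0}(1-e^\alpha),$$ $$\mathrm{stab}_-(w)|_v=q^{\ell(w)/2}\,K^\tau_{w,v}\prod_{\alpha>0,\;v^{-1}\alpha>0}(1-qe^{-\alpha})\prod_{\alpha>0,\;v^{-1}\alpha<0}(1-e^\alpha).$$ -/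

import Mathlib

open scoped TensorProduct

noncomputable section

namespace StableBasis

/-! ### The Weyl group -/

section Weyl

variable {ι X Y : Type*} [AddCommGroup X] [AddCommGroup Y] {P : RootDatum ι X Y}

/-- The simple reflection attached to a simple root. -/
def simpleReflection (b : P.Base) (i : b.support) : P.weylGroup :=
  RootPairing.weylGroup.ofIdx P i

/-- The product `s_{i_1} ⋯ s_{i_k}` of a word in the simple reflections. -/
def wordProd (b : P.Base) (l : List b.support) : P.weylGroup :=
  (l.map (simpleReflection b)).prod

/-- The length of `w`: the least length of an expression of `w` as a product of simple
reflections. -/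
def length (b : P.Base) (w : P.weylGroup) : ℕ :=
  sInf {n | ∃ l : List b.support, wordProd b l = w ∧ l.length = n}

/-- `l` is a reduced decomposition of `w`. -/
def IsReducedWord (b : P.Base) (l : List b.support) (w : P.weylGroup) : Prop :=
  wordProd b l = w ∧ l.length = length b w

/-- The Bruhat order: generated by `u < u t` for reflections `t` with `ℓ(u) < ℓ(u t)`. -/
def BruhatLE (b : P.Base) : P.weylGroup → P.weylGroup → Prop :=
  Relation.ReflTransGen fun u v =>
    (∃ i : ι, v = u * RootPairing.weylGroup.ofIdx P i) ∧ length b u < length b v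

instance (b : P.Base) (u v : P.weylGroup) : Decidable (BruhatLE b u v) := Classical.propDecidable _

lemma ofIdx_reflectionPerm (i j : ι) :
    RootPairing.weylGroup.ofIdx P (P.reflectionPerm j i) =
      RootPairing.weylGroup.ofIdx P j * RootPairing.weylGroup.ofIdx P i *
        RootPairing.weylGroup.ofIdx P j := by
  apply Subtype.ext
  apply RootPairing.Equiv.weightHom_injective P
  ext x
  change P.reflection (P.reflectionPerm j i) x = P.reflection j (P.reflection i (P.reflection j x))
  rw [RootPairing.reflection_reflectionPerm]
  rfl

lemma ofIdx_mul_self (i : ι) :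
    RootPairing.weylGroup.ofIdx P i * RootPairing.weylGroup.ofIdx P i = 1 := by
  rw [mul_eq_one_iff_eq_inv]
  apply Subtype.ext
  exact (RootPairing.Equiv.reflection_inv P i).symm

lemma exists_wordProd_eq [Finite ι] [P.IsReduced] (b : P.Base) (w : P.weylGroup) :
    ∃ l : List b.support, wordProd b l = w := by
  let H : Subgroup P.weylGroup := Subgroup.closure (Set.range (simpleReflection b))
  have hrefl : ∀ i, RootPairing.weylGroup.ofIdx P i ∈ H := by
    intro i
    refine b.induction_reflect (p := fun i => RootPairing.weylGroup.ofIdx P i ∈ H) i (fun i hi => ?_) (fun i hi => ?_) (fun i j hi hj => ?_)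
    · rw [ofIdx_reflectionPerm, ofIdx_mul_self, one_mul]
      exact hi
    · exact Subgroup.subset_closure ⟨⟨i, hi⟩, rfl⟩
    · have hj' : RootPairing.weylGroup.ofIdx P j ∈ H := Subgroup.subset_closure ⟨⟨j, hj⟩, rfl⟩
      rw [ofIdx_reflectionPerm]
      exact H.mul_mem (H.mul_mem hj' hi) hj'
  have hw : w ∈ H := by
    obtain ⟨w, hw⟩ := w
    induction hw using RootPairing.weylGroup.induction with
    | mem i => exact hrefl i
    | one => exact H.one_mem
    | mul x y hx hy hx' hy' => exact H.mul_mem hx' hy'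
  induction hw using Subgroup.closure_induction'' with
  | one => exact ⟨[], rfl⟩
  | mem x hx =>
    obtain ⟨i, rfl⟩ := hx
    exact ⟨[i], by simp [wordProd]⟩
  | inv_mem x hx =>
    obtain ⟨i, rfl⟩ := hx
    refine ⟨[i], ?_⟩
    have := ofIdx_mul_self (P := P) (i : ι)
    simpa [wordProd, simpleReflection] using mul_eq_one_iff_eq_inv.mp this
  | mul x y _ _ hx hy =>
    obtain ⟨l, rfl⟩ := hx
    obtain ⟨m, rfl⟩ := hy
    exact ⟨l ++ m, by simp [wordProd]⟩

lemma exists_isReducedWord [Finite ι] [P.IsReduced] (b : P.Base) (w : P.weylGroup) :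
    ∃ l : List b.support, IsReducedWord b l w := by
  obtain ⟨l, hl⟩ := exists_wordProd_eq b w
  exact Nat.sInf_mem (s := {n | ∃ l : List b.support, wordProd b l = w ∧ l.length = n})
    ⟨l.length, l, hl, rfl⟩

/-- A chosen reduced decomposition of `w`. -/
def reducedWord [Finite ι] [P.IsReduced] (b : P.Base) (w : P.weylGroup) : List b.support :=
  Classical.choose (exists_isReducedWord b w)

lemma eq_one_of_weylGroupToPerm_eq_one [Finite ι] {w : P.weylGroup}
    (hw : P.weylGroupToPerm w = 1) : w = 1 := by
  have := Fintype.ofFinite ι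
  have hroot (i : ι) : w • P.root i = P.root i := by
    rw [RootPairing.weylGroup_apply_root, hw]; rfl
  have hspan : ∀ (v : P.weylGroup) (x : X), v • x - x ∈ P.rootSpan ℤ := by
    rintro ⟨v, hv⟩
    induction hv using RootPairing.weylGroup.induction with
    | mem i =>
      intro x
      have : P.reflection i x - x ∈ P.rootSpan ℤ := by
        rw [RootPairing.reflection_apply, sub_sub_cancel_left]
        exact Submodule.neg_mem _ (Submodule.smul_mem _ _ (Submodule.subset_span ⟨i, rfl⟩))
      exact this
    | one => intro x; simp [Subgroup.mk_smul]
    | mul v u hv hu hv' hu' =>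
      intro x
      have h1 := hv' (u • x)
      have h2 := hu' x
      have := Submodule.add_mem _ h1 h2
      change ((⟨v, hv⟩ : P.weylGroup) * ⟨u, hu⟩) • x - x ∈ _
      rw [mul_smul]
      simpa using this
  have hform : ∀ (v : P.weylGroup) (x y : X), P.RootForm (v • x) (v • y) = P.RootForm x y := by
    rintro ⟨v, hv⟩
    induction hv using RootPairing.weylGroup.induction with
    | mem i => intro x y; exact P.rootForm_reflection_reflection_apply i x y
    | one => intro x y; simp [Subgroup.mk_smul]
    | mul v u hv hu hv' hu' =>
      intro x y
      have := (hv' (u • x) (u • y)).trans (hu' x y)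
      change P.RootForm (((⟨v, hv⟩ : P.weylGroup) * ⟨u, hu⟩) • x)
        (((⟨v, hv⟩ : P.weylGroup) * ⟨u, hu⟩) • y) = _
      rw [mul_smul, mul_smul]
      exact this
  have hfix (x : X) : w • x = x := by
    rw [← sub_eq_zero]
    have hx := hspan w x
    refine P.eq_zero_of_mem_rootSpan_of_rootForm_self_eq_zero hx ?_
    have h0 : ∀ z ∈ P.rootSpan ℤ, P.RootForm (w • x - x) z = 0 := by
      intro z hz
      induction hz using Submodule.span_induction with
      | mem z hz =>
        obtain ⟨i, rfl⟩ := hz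
        have := hform w x (P.root i)
        rw [hroot] at this
        simp [this]
      | zero => simp
      | add y z _ _ hy hz => rw [map_add, hy, hz, add_zero]
      | smul c z _ hz => rw [map_smul, hz, smul_zero]
    exact h0 _ hx
  apply Subtype.ext
  apply RootPairing.Equiv.weightHom_injective P
  ext x
  exact hfix x

instance [Finite ι] : Finite P.weylGroup :=
  Finite.of_injective P.weylGroupToPerm <| by
    rw [injective_iff_map_eq_one]
    exact fun w hw => eq_one_of_weylGroupToPerm_eq_one hw

instance [Finite ι] : Fintype P.weylGroup := Fintype.ofFinite _

/-- The longest element `w₀` of the Weyl group. -/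
def longest [Finite ι] (b : P.Base) : P.weylGroup :=
  Classical.choose (Finite.exists_max (length b))

instance (b : P.Base) (j : ι) : Decidable (b.IsPos j) := Classical.propDecidable _

/-- `Σ_w = w Σ⁻ ∩ Σ⁺`, as a set of indices of roots. -/
def inversions [Fintype ι] (b : P.Base) (w : P.weylGroup) : Finset ι :=
  Finset.univ.filter fun j => b.IsPos j ∧ ¬ b.IsPos (w⁻¹ • j)

end Weyl

/-! ### The coefficient rings `R`, `S`, `Q` -/

/-- `R = ℤ[q^{1/2}, q^{-1/2}]`; the variable of the Laurent polynomials is `q^{1/2}`. -/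
abbrev CoeffRing : Type := LaurentPolynomial ℤ

/-- `S = R[Λ]`, the group algebra of the lattice `X = Λ`. -/
abbrev LatticeRing (X : Type*) [AddCommGroup X] : Type _ := AddMonoidAlgebra CoeffRing X

instance (X : Type*) [AddCommGroup X] [Module.Free ℤ X] : TwoUniqueSums X :=
  TwoUniqueSums.of_injective_addHom (Module.Free.chooseBasis ℤ X).repr.toAddEquiv.toAddHom
    (Module.Free.chooseBasis ℤ X).repr.injective inferInstance

/-- `Q = Frac S`. -/
def FracField (X : Type*) [AddCommGroup X] : Type _ := FractionRing (LatticeRing X)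

section FracFieldInstances

variable (X : Type*) [AddCommGroup X] [Module.Free ℤ X]

instance : Field (FracField X) := inferInstanceAs (Field (FractionRing (LatticeRing X)))

instance : Algebra (LatticeRing X) (FracField X) :=
  inferInstanceAs (Algebra (LatticeRing X) (FractionRing (LatticeRing X)))

instance : IsFractionRing (LatticeRing X) (FracField X) :=
  inferInstanceAs (IsFractionRing (LatticeRing X) (FractionRing (LatticeRing X)))

instance : Algebra CoeffRing (FracField X) :=
  inferInstanceAs (Algebra CoeffRing (FractionRing (LatticeRing X)))

instance : IsScalarTower CoeffRing (LatticeRing X) (FracField X) :=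
  inferInstanceAs (IsScalarTower CoeffRing (LatticeRing X) (FractionRing (LatticeRing X)))

end FracFieldInstances

/-- `q^{n/2}` in `Q`. -/
def qHalf (X : Type*) [AddCommGroup X] [Module.Free ℤ X] (n : ℤ) : FracField X :=
  algebraMap CoeffRing (FracField X) (LaurentPolynomial.T n)

/-- The element `q` of `Q`. -/
def q (X : Type*) [AddCommGroup X] [Module.Free ℤ X] : FracField X := qHalf X 2

/-- The exponential `e^x ∈ Q` of a character `x ∈ Λ`. -/
def ex {X : Type*} [AddCommGroup X] [Module.Free ℤ X] (x : X) : FracField X :=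
  algebraMap (LatticeRing X) (FracField X) (AddMonoidAlgebra.single x 1)

section Rings

variable {ι X Y : Type*} [AddCommGroup X] [AddCommGroup Y] [Module.Free ℤ X]
  {P : RootDatum ι X Y}

/-- The Weyl group acts on `S` by `w(r e^x) = r e^{w x}`. -/
def latticeRingAction (P : RootDatum ι X Y) :
    P.weylGroup →* (LatticeRing X ≃+* LatticeRing X) where
  toFun w := (AddMonoidAlgebra.domCongr CoeffRing CoeffRing
    (DistribMulAction.toAddEquiv X w)).toRingEquiv
  map_one' := by
    ext x : 1
    induction x using AddMonoidAlgebra.induction_linear <;> simp_all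
  map_mul' v w := by
    ext x : 1
    induction x using AddMonoidAlgebra.induction_linear <;> simp_all [mul_smul]

/-- The induced action of the Weyl group on `Q` by field automorphisms. -/
instance : MulSemiringAction P.weylGroup (FracField X) :=
  MulSemiringAction.compHom (FracField X)
    ((IsFractionRing.ringEquivOfRingEquivHom (LatticeRing X) (FracField X)).comp
      (latticeRingAction P))

lemma smul_algebraMap_latticeRing (w : P.weylGroup) (s : LatticeRing X) :
    w • algebraMap (LatticeRing X) (FracField X) s =
      algebraMap (LatticeRing X) (FracField X) (latticeRingAction P w s) :=
  IsFractionRing.ringEquivOfRingEquiv_algebraMap _ _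

lemma smul_ex (w : P.weylGroup) (x : X) : w • ex x = ex (w • x) := by
  rw [ex, smul_algebraMap_latticeRing]
  simp [latticeRingAction, ex]

lemma smul_algebraMap_coeffRing (w : P.weylGroup) (r : CoeffRing) :
    w • algebraMap CoeffRing (FracField X) r = algebraMap CoeffRing (FracField X) r := by
  rw [IsScalarTower.algebraMap_apply CoeffRing (LatticeRing X) (FracField X),
    smul_algebraMap_latticeRing]
  simp [latticeRingAction]

instance : SMulCommClass P.weylGroup CoeffRing (FracField X) where
  smul_comm w r x := by
    rw [Algebra.smul_def, Algebra.smul_def, smul_mul', smul_algebraMap_coeffRing]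

/-- The twisted group algebra `Q_W = Q ⋊ R[W]`, with product `p δ_u · p' δ_v = p u(p') δ_{uv}`. -/
abbrev TwistedAlgebra (P : RootDatum ι X Y) : Type _ :=
  SkewMonoidAlgebra (FracField X) P.weylGroup

/-- The basis element `δ_w` of `Q_W`. -/
def δ (w : P.weylGroup) : TwistedAlgebra P := SkewMonoidAlgebra.single w 1

/-- The dual `Q_W^* = Hom_Q(Q_W, Q)`, which is `Hom(W, Q)` through the basis `δ_w`. -/
abbrev DualAlgebra (P : RootDatum ι X Y) : Type _ :=
  Module.Dual (FracField X) (TwistedAlgebra P)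

end Rings

section Elements

variable {ι X Y : Type*} [AddCommGroup X] [AddCommGroup Y] [Module.Free ℤ X]
  {P : RootDatum ι X Y}

/-- The standard basis element `f_w` of `Q_W^*`, with `f_w(δ_v) = δ_{w,v}`. -/
def f (w : P.weylGroup) : DualAlgebra P := SkewMonoidAlgebra.basisSingleOne.coord w

/-- The action `(z • f)(z') = f(z' z)` of `Q_W` on `Q_W^*`. -/
def bullet (z : TwistedAlgebra P) (g : DualAlgebra P) : DualAlgebra P :=
  g ∘ₗ LinearMap.mulRight (FracField X) z

/-! ### The elements `x_w`, `x_{-w}`, `\hat x_w` -/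

/-- `x_λ = 1 - e^{-λ}`. -/
def xx (x : X) : FracField X := 1 - ex (-x)

/-- `\tilde x_λ = q - e^λ`. -/
def xTilde (x : X) : FracField X := q X - ex x

/-- `\hat x_λ = 1 - q e^{-λ}`. -/
def xHat (x : X) : FracField X := 1 - q X * ex (-x)

/-- `x_{-w} = ∏_{β ∈ Σ_w} x_{-β}`. -/
def xNegW [Fintype ι] (b : P.Base) (w : P.weylGroup) : FracField X :=
  ∏ j ∈ inversions b w, xx (-P.root j)

/-- `\hat x_w = ∏_{β ∈ Σ_w} \hat x_β`. -/
def xHatW [Fintype ι] (b : P.Base) (w : P.weylGroup) : FracField X :=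
  ∏ j ∈ inversions b w, xHat (P.root j)

/-- `q_w = q^{ℓ(w)}`. -/
def qW (b : P.Base) (w : P.weylGroup) : FracField X := q X ^ length b w

/-! ### Demazure–Lusztig elements -/

/-- The push-pull element `Y_α = 1/x_{-α} + (1/x_α) δ_α`, for `α` the root of index `i`. -/
def pushPull (P : RootDatum ι X Y) (i : ι) : TwistedAlgebra P :=
  (xx (-P.root i))⁻¹ • 1 + (xx (P.root i))⁻¹ • δ (RootPairing.weylGroup.ofIdx P i)

/-- The push-pull element `Y_{-α} = 1/x_α + (1/x_{-α}) δ_α`. -/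
def pushPullNeg (P : RootDatum ι X Y) (i : ι) : TwistedAlgebra P :=
  (xx (P.root i))⁻¹ • 1 + (xx (-P.root i))⁻¹ • δ (RootPairing.weylGroup.ofIdx P i)

/-- `τ⁺_α = \tilde x_α Y_α - 1`. -/
def simpleTauPlus (P : RootDatum ι X Y) (i : ι) : TwistedAlgebra P :=
  xTilde (P.root i) • pushPull P i - 1

/-- `τ⁻_α = \hat x_α Y_{-α} - 1`. -/
def simpleTauMinus (P : RootDatum ι X Y) (i : ι) : TwistedAlgebra P :=
  xHat (P.root i) • pushPullNeg P i - 1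

variable [Fintype ι] [P.IsReduced]

/-- `τ⁺_w = τ⁺_{i_1} ⋯ τ⁺_{i_k}` for a reduced decomposition of `w`. -/
def tauPlus (b : P.Base) (w : P.weylGroup) : TwistedAlgebra P :=
  ((reducedWord b w).map fun i : b.support => simpleTauPlus P i).prod

/-- `τ⁻_w = τ⁻_{i_1} ⋯ τ⁻_{i_k}` for a reduced decomposition of `w`. -/
def tauMinus (b : P.Base) (w : P.weylGroup) : TwistedAlgebra P :=
  ((reducedWord b w).map fun i : b.support => simpleTauMinus P i).prod

/-- The coefficient `a⁺_{w,v}` in `τ⁺_w = ∑_v a⁺_{w,v} δ_v`. -/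
def aPlus (b : P.Base) (w v : P.weylGroup) : FracField X := (tauPlus b w).coeff v

/-! ### The algebraic stable bases -/

/-- `pt_w = x_{-w₀} f_w`. -/
def pt (b : P.Base) (w : P.weylGroup) : DualAlgebra P := xNegW b (longest b) • f w

/-- `St⁺_w = τ⁺_{w⁻¹} • pt_e`. -/
def StPlus (b : P.Base) (w : P.weylGroup) : DualAlgebra P :=
  bullet (tauPlus b w⁻¹) (pt b 1)

/-- `St⁻_w = (τ⁻_{w₀ w})⁻¹ • pt_{w₀}`. -/
def StMinus (b : P.Base) (w : P.weylGroup) : DualAlgebra P :=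
  bullet (Ring.inverse (tauMinus b (longest b * w))) (pt b (longest b))

/-- The algebraic model `q_w^{-1/2} St⁺_w` of the stable basis element for the positive chamber. -/
def stabPlus (b : P.Base) (w : P.weylGroup) : DualAlgebra P :=
  qHalf X (-(length b w : ℤ)) • StPlus b w

/-- The algebraic model `q_{w₀} q_w^{-1/2} St⁻_w` of the stable basis element for the negative
chamber. -/
def stabMinus (b : P.Base) (w : P.weylGroup) : DualAlgebra P :=
  (qW b (longest b) * qHalf X (-(length b w : ℤ))) • StMinus b w

/-- The restriction `g|_v`, that is the coefficient of `f_v` in `g ∈ Q_W^*`. -/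
def restrict (g : DualAlgebra P) (v : P.weylGroup) : FracField X := g (δ v)

/-! ### Root polynomials -/

/-- The ring `\hat Q_W = Q^y ⊗_R Q_W^x`, in which `Q^y` commutes with `Q_W^x`. -/
abbrev BigAlgebra (P : RootDatum ι X Y) : Type _ :=
  FracField X ⊗[CoeffRing] TwistedAlgebra P

/-- The product of the factors `h_{i_j}(β_j) = τ_{i_j}^x - (q-1)/y_{-β_j}` along a word
`i_1, …, i_l`, where `β_j = u s_{i_1} ⋯ s_{i_{j-1}} α_{i_j}`. Here `τ` is the family of
Demazure–Lusztig elements used (`τ⁺` or `τ⁻`). -/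
def rootPolyFrom (b : P.Base) (τ : ι → TwistedAlgebra P) :
    P.weylGroup → List b.support → BigAlgebra P
  | _, [] => 1
  | u, i :: l =>
      ((1 : FracField X) ⊗ₜ[CoeffRing] τ i
        - ((q X - 1) / xx (-(u • P.root i))) ⊗ₜ[CoeffRing] (1 : TwistedAlgebra P))
      * rootPolyFrom b τ (u * simpleReflection b i) l

/-- The root polynomial `R^τ` of a word. -/
def rootPoly (b : P.Base) (τ : ι → TwistedAlgebra P) (l : List b.support) : BigAlgebra P :=
  rootPolyFrom b τ 1 l

/-- `K v w` (`v, w ∈ W`) are the root polynomial coefficients `K^τ_{v,w} ∈ Q^y`: for every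
reduced decomposition of `w` and for both signs, `R^τ_w = ∑_v K^τ_{v,w} τ_v^x`, and only `v ≤ w`
contribute. -/
def IsRootPolyCoeff (b : P.Base) (K : P.weylGroup → P.weylGroup → FracField X) : Prop :=
  (∀ w l, IsReducedWord b l w →
    rootPoly b (simpleTauPlus P) l = ∑ v, K v w ⊗ₜ[CoeffRing] tauPlus b v ∧
    rootPoly b (simpleTauMinus P) l = ∑ v, K v w ⊗ₜ[CoeffRing] tauMinus b v) ∧
  ∀ v w, ¬ BruhatLE b v w → K v w = 0

end Elements

end StableBasis

end

/-! Both families have the shape $\tau_\alpha=d(\alpha)+c_\alpha\delta_\alpha$ with the same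
constant term $d(\alpha)=(q-1)/x_{-\alpha}$. Only the $W$-equivariant coefficients $c_\alpha$
differ, and in both cases $c_\alpha c_{-\alpha}=q+d(\alpha)(q-1-d(\alpha))$. The algebra is
therefore done once, for an abstract `HeckeCocycle`, and applied to `plusCocycle` and
`minusCocycle`.

Independence of the reduced word: the intertwiners $c_\alpha\delta_\alpha$ multiply along a reduced
word of $w$ to $c_w\delta_w$ with $c_w=\prod_{\beta\in\Sigma_w}c_\beta$ (`prod_intertwiner`), so
they satisfy the braid relations. Expanding the $\tau$'s in intertwiners reduces their braid
relations to identities between the $d(\beta)$ of a rank two system, all of which follow from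
`dlConst_neg` and `dlConst_add`. Matsumoto's theorem (`prod_map_eq_of_isReducedWord`) concludes.

Root polynomials: the quadratic relation and the word-independence of $\tau_w$ give a recursion for
the coefficients of $\mathcal R_w$ (`wordCoeff`) which involves only $q$ and $d$, hence is the same
for both signs. The same recursion expands $c_w\delta_w$ in the $\tau_v$ (`cW_smul_δ`), because
$\tau_\alpha-d(\alpha)$ is the intertwiner. Thus the $\tau_v$ form a basis, $K_{v,w}$ is $c_w$ times
a coordinate of $\delta_w$, and independence of the word and uniqueness follow.

Stable bases: $\mathrm{St}^+$ is read off from the product in $Q_W$. For $\mathrm{St}^-$ the key is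
`coeff_longest_tau_mul_inverse`: the coefficient of $\delta_{w_0}$ in $\tau_v\tau_u^{-1}$ vanishes
unless $v=w_0u$. So $\mathrm{St}^-_w$ is a multiple of the dual basis vector of $\tau^-_w$. The
remaining formulas use $\hat x_{w_0}=v(\hat x_{v^{-1}w_0})\,\hat x_v$ and
$\ell(w_0w)+\ell(w)=\ell(w_0)$. -/

noncomputable section

namespace StableBasis

/-! ### Weyl group combinatorics: reflections, length and the exchange property. -/

section WeylCombinatorics

set_option linter.unusedSectionVars false

variable {ι X Y : Type*} [AddCommGroup X] [AddCommGroup Y] {P : RootDatum ι X Y}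

lemma root_smul_index (w : P.weylGroup) (j : ι) : P.root (w • j) = w • P.root j :=
  (P.weylGroup_apply_root w j).symm

lemma ofIdx_smul_index (i j : ι) :
    RootPairing.weylGroup.ofIdx P i • j = P.reflectionPerm i j := rfl

lemma ofIdx_inv (i : ι) :
    (RootPairing.weylGroup.ofIdx P i)⁻¹ = RootPairing.weylGroup.ofIdx P i :=
  (mul_eq_one_iff_inv_eq.mp (ofIdx_mul_self i))

lemma smul_reflectionPerm (w : P.weylGroup) (i j : ι) :
    w • P.reflectionPerm i j = P.reflectionPerm (w • i) (w • j) := by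
  obtain ⟨w, hw⟩ := w
  induction hw using RootPairing.weylGroup.induction generalizing i j with
  | mem k =>
    apply P.root.injective
    have h1 : (⟨_, P.reflection_mem_weylGroup k⟩ : P.weylGroup) =
      RootPairing.weylGroup.ofIdx P k := rfl
    have h (a c : ι) : P.reflectionPerm k (P.reflectionPerm a c) =
        P.reflectionPerm (P.reflectionPerm k a) (P.reflectionPerm k c) := by
      apply P.root.injective
      rw [P.root_reflectionPerm (P.reflectionPerm k a), RootPairing.reflection_reflectionPerm]
      simp [RootPairing.root_reflectionPerm]
    exact congrArg _ (h i j)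
  | one => rfl
  | mul v u hv hu hv' hu' =>
    exact (congrArg (fun k => (⟨v, hv⟩ : P.weylGroup) • k) (hu' i j)).trans (hv' _ _)

lemma ofIdx_smul (w : P.weylGroup) (i : ι) :
    RootPairing.weylGroup.ofIdx P (w • i) = w * RootPairing.weylGroup.ofIdx P i * w⁻¹ := by
  obtain ⟨w, hw⟩ := w
  induction hw using RootPairing.weylGroup.induction generalizing i with
  | mem k =>
    have h1 : (⟨_, P.reflection_mem_weylGroup k⟩ : P.weylGroup) =
      RootPairing.weylGroup.ofIdx P k := rfl
    rw [h1, ofIdx_smul_index, ofIdx_reflectionPerm, ofIdx_inv]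
  | one => change RootPairing.weylGroup.ofIdx P i = 1 * _ * 1⁻¹; simp
  | mul v u hv hu hv' hu' =>
    change RootPairing.weylGroup.ofIdx P
      ((⟨v, hv⟩ : P.weylGroup) • (⟨u, hu⟩ : P.weylGroup) • i) =
      ((⟨v, hv⟩ : P.weylGroup) * ⟨u, hu⟩) * _ * ((⟨v, hv⟩ : P.weylGroup) * ⟨u, hu⟩)⁻¹
    rw [hv', hu', mul_inv_rev]
    group

/-- The index of the root opposite to the root of index `i`. -/
def negIdx (P : RootDatum ι X Y) (i : ι) : ι := P.reflectionPerm i i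

@[simp] lemma root_negIdx (i : ι) : P.root (negIdx P i) = -P.root i := by
  simp [negIdx, RootPairing.root_reflectionPerm]

lemma smul_negIdx (w : P.weylGroup) (i : ι) : w • negIdx P i = negIdx P (w • i) :=
  smul_reflectionPerm w i i

lemma ofIdx_negIdx (i : ι) :
    RootPairing.weylGroup.ofIdx P (negIdx P i) = RootPairing.weylGroup.ofIdx P i := by
  rw [negIdx, ofIdx_reflectionPerm, ofIdx_mul_self, one_mul]

@[simp] lemma isPos_negIdx (b : P.Base) (i : ι) : b.IsPos (negIdx P i) ↔ ¬ b.IsPos i :=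
  RootPairing.Base.IsPos.neg_iff_not b i

lemma isPos_simple (b : P.Base) (i : b.support) : b.IsPos (i : ι) :=
  RootPairing.Base.isPos_of_mem_support i.2

lemma simpleReflection_mul_self (b : P.Base) (i : b.support) :
    simpleReflection b i * simpleReflection b i = 1 := ofIdx_mul_self _

lemma simpleReflection_inv (b : P.Base) (i : b.support) :
    (simpleReflection b i)⁻¹ = simpleReflection b i := ofIdx_inv _

@[simp] lemma simpleReflection_mul_cancel_left (b : P.Base) (i : b.support) (w : P.weylGroup) :
    simpleReflection b i * (simpleReflection b i * w) = w := by
  rw [← mul_assoc, simpleReflection_mul_self, one_mul]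

lemma simpleReflection_smul_self (b : P.Base) (i : b.support) :
    simpleReflection b i • (i : ι) = negIdx P i := rfl

@[simp] lemma wordProd_nil (b : P.Base) : wordProd b [] = 1 := rfl

@[simp] lemma wordProd_cons (b : P.Base) (i : b.support) (l : List b.support) :
    wordProd b (i :: l) = simpleReflection b i * wordProd b l := by simp [wordProd]

@[simp] lemma wordProd_append (b : P.Base) (l m : List b.support) :
    wordProd b (l ++ m) = wordProd b l * wordProd b m := by simp [wordProd]

lemma wordProd_reverse (b : P.Base) (l : List b.support) :
    wordProd b l.reverse = (wordProd b l)⁻¹ := by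
  induction l with
  | nil => simp
  | cons i l ih => simp [ih, simpleReflection_inv]

lemma length_wordProd_le (b : P.Base) (l : List b.support) :
    length b (wordProd b l) ≤ l.length :=
  Nat.sInf_le ⟨l, rfl, rfl⟩

@[simp] lemma length_one (b : P.Base) : length b (1 : P.weylGroup) = 0 :=
  Nat.le_zero.mp (length_wordProd_le b [])

variable [Finite ι] [P.IsReduced] (b : P.Base)

lemma isPos_simpleReflection_smul {i : b.support} {j : ι} (hj : b.IsPos j) (hij : j ≠ i) :
    b.IsPos (simpleReflection b i • j) :=
  RootPairing.Base.IsPos.reflectionPerm hj i.2 hij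

lemma eq_of_not_isPos_simpleReflection_smul {i : b.support} {j : ι} (hj : b.IsPos j)
    (h : ¬ b.IsPos (simpleReflection b i • j)) : j = i := by
  by_contra hij
  exact h (isPos_simpleReflection_smul b hj hij)

lemma length_inv_le (w : P.weylGroup) : length b w⁻¹ ≤ length b w := by
  obtain ⟨l, rfl, hl⟩ := exists_isReducedWord b w
  rw [← hl, ← wordProd_reverse, ← List.length_reverse]
  exact length_wordProd_le b _

@[simp] lemma length_inv (w : P.weylGroup) : length b w⁻¹ = length b w :=
  le_antisymm (length_inv_le b w) (by simpa using length_inv_le b w⁻¹)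

lemma eq_one_of_length_eq_zero {w : P.weylGroup} (h : length b w = 0) : w = 1 := by
  obtain ⟨l, rfl, hl⟩ := exists_isReducedWord b w
  rw [h, List.length_eq_zero_iff] at hl
  simp [hl]

lemma length_simpleReflection_mul_le (i : b.support) (w : P.weylGroup) :
    length b (simpleReflection b i * w) ≤ length b w + 1 := by
  obtain ⟨l, rfl, hl⟩ := exists_isReducedWord b w
  rw [← hl, ← wordProd_cons]
  exact length_wordProd_le b _

/-- Exchange property: the letter at which the positive root `j` changes sign. -/
lemma exists_letter_of_not_isPos (l : List b.support) {j : ι} (hj : b.IsPos j)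
    (h : ¬ b.IsPos ((wordProd b l)⁻¹ • j)) :
    ∃ (l₁ : List b.support) (i : b.support) (l₂ : List b.support), l = l₁ ++ i :: l₂ ∧ (wordProd b l₁)⁻¹ • j = (i : ι) := by
  induction l generalizing j with
  | nil => simp [hj] at h
  | cons i l ih =>
    by_cases hij : j = i
    · exact ⟨[], i, l, rfl, by simpa using hij⟩
    · obtain ⟨l₁, k, l₂, rfl, hk⟩ := ih (j := simpleReflection b i • j)
        (isPos_simpleReflection_smul b hj hij)
        (by simpa [mul_smul, simpleReflection_inv] using h)
      exact ⟨i :: l₁, k, l₂, rfl, by simpa [mul_smul, simpleReflection_inv] using hk⟩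

lemma ofIdx_mul_wordProd {l₁ : List b.support} {i : b.support} {j : ι}
    (h : (wordProd b l₁)⁻¹ • j = (i : ι)) :
    RootPairing.weylGroup.ofIdx P j * wordProd b l₁ = wordProd b l₁ * simpleReflection b i := by
  have := ofIdx_smul (wordProd b l₁)⁻¹ j
  rw [h] at this
  rw [simpleReflection, this]
  group

/-- The sign of the root changes at some letter of a reduced word of $w$, and multiplying by its
reflection deletes that letter. -/
lemma length_ofIdx_mul_lt {w : P.weylGroup} {j : ι} (hj : b.IsPos j) (h : ¬ b.IsPos (w⁻¹ • j)) :
    length b (RootPairing.weylGroup.ofIdx P j * w) < length b w := by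
  obtain ⟨l, rfl, hl⟩ := exists_isReducedWord b w
  obtain ⟨l₁, i, l₂, rfl, hi⟩ := exists_letter_of_not_isPos b l hj h
  have : RootPairing.weylGroup.ofIdx P j * wordProd b (l₁ ++ i :: l₂) = wordProd b (l₁ ++ l₂) := by
    rw [wordProd_append, ← mul_assoc, ofIdx_mul_wordProd b hi]
    simp [mul_assoc]
  rw [this, ← hl]
  refine (length_wordProd_le b _).trans_lt ?_
  simp

lemma length_lt_ofIdx_mul {w : P.weylGroup} {j : ι} (hj : b.IsPos j) (h : b.IsPos (w⁻¹ • j)) :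
    length b w < length b (RootPairing.weylGroup.ofIdx P j * w) := by
  -- The strict decrease is applied to $s_jw$, whose inverse sends $j$ to a negative root.
  have := length_ofIdx_mul_lt b (w := RootPairing.weylGroup.ofIdx P j * w) hj (by
    rw [mul_inv_rev, mul_smul, ofIdx_inv]
    change ¬ b.IsPos (w⁻¹ • negIdx P j)
    simpa [smul_negIdx] using h)
  rwa [← mul_assoc, ofIdx_mul_self, one_mul] at this

lemma length_mul_ofIdx (w : P.weylGroup) (j : ι) :
    length b (w * RootPairing.weylGroup.ofIdx P j) =
      length b (RootPairing.weylGroup.ofIdx P j * w⁻¹) := by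
  rw [← length_inv, mul_inv_rev, ofIdx_inv]

lemma length_lt_mul_ofIdx_iff {w : P.weylGroup} {j : ι} (hj : b.IsPos j) :
    length b w < length b (w * RootPairing.weylGroup.ofIdx P j) ↔ b.IsPos (w • j) := by
  rw [length_mul_ofIdx]
  constructor
  · intro h
    by_contra h'
    have := length_ofIdx_mul_lt b (w := w⁻¹) hj (by simpa using h')
    simp only [length_inv] at this
    exact this.not_gt h
  · intro h
    simpa using length_lt_ofIdx_mul b (w := w⁻¹) hj (by simpa using h)

lemma length_simpleReflection_mul {i : b.support} {w : P.weylGroup}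
    (h : b.IsPos (w⁻¹ • (i : ι))) :
    length b (simpleReflection b i * w) = length b w + 1 :=
  le_antisymm (length_simpleReflection_mul_le b i w)
    (length_lt_ofIdx_mul b (isPos_simple b i) h)

lemma length_simpleReflection_mul' {i : b.support} {w : P.weylGroup}
    (h : ¬ b.IsPos (w⁻¹ • (i : ι))) :
    length b (simpleReflection b i * w) + 1 = length b w := by
  have := length_simpleReflection_mul b (i := i) (w := simpleReflection b i * w) (by
    rw [mul_inv_rev, mul_smul, simpleReflection_inv, simpleReflection_smul_self, smul_negIdx]
    simpa using h)
  rw [← this, simpleReflection_mul_cancel_left]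

lemma length_mul_simpleReflection {i : b.support} {w : P.weylGroup} (h : b.IsPos (w • (i : ι))) :
    length b (w * simpleReflection b i) = length b w + 1 := by
  have := length_simpleReflection_mul b (i := i) (w := w⁻¹) (by simpa using h)
  rwa [length_inv, ← length_inv, mul_inv_rev, inv_inv, simpleReflection_inv] at this

lemma length_mul_simpleReflection' {i : b.support} {w : P.weylGroup}
    (h : ¬ b.IsPos (w • (i : ι))) :
    length b (w * simpleReflection b i) + 1 = length b w := by
  have := length_simpleReflection_mul' b (i := i) (w := w⁻¹) (by simpa using h)
  rwa [length_inv, ← length_inv, mul_inv_rev, inv_inv, simpleReflection_inv] at this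

/-! ### Reduced words -/

variable {b}

lemma IsReducedWord.tail {i : b.support} {l : List b.support} {w : P.weylGroup}
    (h : IsReducedWord b (i :: l) w) : IsReducedWord b l (wordProd b l) := by
  refine ⟨rfl, le_antisymm ?_ (length_wordProd_le b l)⟩
  have h1 := length_simpleReflection_mul_le b i (wordProd b l)
  rw [← wordProd_cons, h.1, ← h.2] at h1
  simpa using h1

lemma IsReducedWord.isPos_head {i : b.support} {l : List b.support} {w : P.weylGroup}
    (h : IsReducedWord b (i :: l) w) : b.IsPos ((wordProd b l)⁻¹ • (i : ι)) := by
  by_contra h'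
  have h1 := length_simpleReflection_mul' b h'
  have h2 := h.tail.2
  have h3 := h.2
  rw [← h.1, wordProd_cons] at h3
  simp at h3
  omega

lemma IsReducedWord.cons {i : b.support} {l : List b.support} {w : P.weylGroup}
    (h : IsReducedWord b l w) (hi : b.IsPos (w⁻¹ • (i : ι))) :
    IsReducedWord b (i :: l) (simpleReflection b i * w) := by
  refine ⟨by simp [h.1], ?_⟩
  rw [length_simpleReflection_mul b hi, List.length_cons, h.2]

lemma IsReducedWord.reverse {l : List b.support} {w : P.weylGroup} (h : IsReducedWord b l w) :
    IsReducedWord b l.reverse w⁻¹ := by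
  refine ⟨by rw [wordProd_reverse, h.1], by simp [h.2]⟩

lemma IsReducedWord.of_append_right {l m : List b.support} {w : P.weylGroup}
    (h : IsReducedWord b (l ++ m) w) : IsReducedWord b m (wordProd b m) := by
  induction l generalizing w with
  | nil => exact ⟨rfl, by rw [← List.nil_append m, h.1]; exact h.2⟩
  | cons i l ih => exact ih h.tail

lemma IsReducedWord.of_append_left {l m : List b.support} {w : P.weylGroup}
    (h : IsReducedWord b (l ++ m) w) : IsReducedWord b l (wordProd b l) := by
  have := h.reverse
  rw [List.reverse_append] at this
  have := this.of_append_right.reverse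
  rwa [wordProd_reverse, inv_inv, List.reverse_reverse] at this

variable (b)

lemma isReducedWord_reducedWord (w : P.weylGroup) : IsReducedWord b (reducedWord b w) w :=
  Classical.choose_spec (exists_isReducedWord b w)

/-- Induction on the Weyl group along left multiplication by simple reflections which raise the
length. -/
lemma weyl_induction_left {p : P.weylGroup → Prop} (one : p 1)
    (mul : ∀ (i : b.support) w, b.IsPos (w⁻¹ • (i : ι)) → p w → p (simpleReflection b i * w))
    (w : P.weylGroup) : p w := by
  obtain ⟨l, hl⟩ := exists_isReducedWord b w
  induction l generalizing w with
  | nil => obtain rfl := hl.1; exact one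
  | cons i l ih =>
    obtain rfl := hl.1
    rw [wordProd_cons]
    exact mul i _ hl.isPos_head (ih _ hl.tail)

lemma weyl_induction_right {p : P.weylGroup → Prop} (one : p 1)
    (mul : ∀ (i : b.support) w, b.IsPos (w • (i : ι)) → p w → p (w * simpleReflection b i))
    (w : P.weylGroup) : p w := by
  have := weyl_induction_left b (p := fun w => p w⁻¹) (by simpa using one)
    (fun i w h hw => by simpa [simpleReflection_inv] using mul i w⁻¹ h hw) w⁻¹
  simpa using this

/-! ### The Bruhat order -/

variable {b}

lemma BruhatLE.refl (w : P.weylGroup) : BruhatLE b w w := Relation.ReflTransGen.refl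

lemma BruhatLE.trans {u v w : P.weylGroup} (h : BruhatLE b u v) (h' : BruhatLE b v w) :
    BruhatLE b u w := Relation.ReflTransGen.trans h h'

lemma BruhatLE.eq_or_length_lt {u w : P.weylGroup} (h : BruhatLE b u w) :
    u = w ∨ length b u < length b w := by
  induction h with
  | refl => exact .inl rfl
  | tail _ h ih =>
    rcases ih with rfl | ih
    · exact .inr h.2
    · exact .inr (ih.trans h.2)

/-- The order is generated by right multiplications. A left reflection is a right one after
conjugation: $s_ju=u\,s_{u^{-1}j}$. -/
lemma BruhatLE.ofIdx_mul {u : P.weylGroup} {j : ι}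
    (h : length b u < length b (RootPairing.weylGroup.ofIdx P j * u)) :
    BruhatLE b u (RootPairing.weylGroup.ofIdx P j * u) := by
  refine Relation.ReflTransGen.single ⟨⟨u⁻¹ • j, ?_⟩, h⟩
  rw [ofIdx_smul]
  group

lemma BruhatLE.inv {u w : P.weylGroup} (h : BruhatLE b u w) : BruhatLE b u⁻¹ w⁻¹ := by
  induction h with
  | refl => exact .refl _
  | @tail v w _ h ih =>
    obtain ⟨⟨j, rfl⟩, h⟩ := h
    refine ih.trans ?_
    rw [mul_inv_rev, ofIdx_inv]
    refine .ofIdx_mul ?_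
    rwa [length_inv, ← length_mul_ofIdx]

lemma bruhatLE_inv_iff {u w : P.weylGroup} : BruhatLE b u⁻¹ w⁻¹ ↔ BruhatLE b u w :=
  ⟨fun h => by simpa using h.inv, .inv⟩

lemma exists_isPos_ofIdx_eq (b : P.Base) (j : ι) :
    ∃ k, b.IsPos k ∧ RootPairing.weylGroup.ofIdx P k = RootPairing.weylGroup.ofIdx P j := by
  by_cases h : b.IsPos j
  · exact ⟨j, h, rfl⟩
  · exact ⟨negIdx P j, by simpa using h, ofIdx_negIdx j⟩

/-- The lifting property of the Bruhat order. -/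
lemma BruhatLE.simpleReflection_mul_or {u w : P.weylGroup} (h : BruhatLE b u w) (i : b.support) :
    BruhatLE b (simpleReflection b i * u) w ∨
      BruhatLE b (simpleReflection b i * u) (simpleReflection b i * w) := by
  induction h with
  | refl => exact .inr (.refl _)
  | @tail v w _ h ih =>
    have hvw : BruhatLE b v w := Relation.ReflTransGen.single h
    rcases ih with ih | ih
    · exact .inl (ih.trans hvw)
    obtain ⟨⟨j, hj⟩, h⟩ := h
    obtain ⟨k, hk, hjk⟩ := exists_isPos_ofIdx_eq b j
    rw [← hjk] at hj
    subst hj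
    rw [length_lt_mul_ofIdx_iff b hk] at h
    by_cases h' : b.IsPos (simpleReflection b i • v • k)
    · refine .inr (ih.trans (Relation.ReflTransGen.single ⟨⟨k, by rw [mul_assoc]⟩, ?_⟩))
      rw [← mul_assoc, length_lt_mul_ofIdx_iff b hk, mul_smul]
      exact h'
    -- A simple reflection makes only its own root negative, so here $v\cdot k=\alpha_i$ and
    -- $s_iv=vs_k$ is the upper element itself.
    · have h1 := eq_of_not_isPos_simpleReflection_smul b h h'
      have h2 : simpleReflection b i * v = v * RootPairing.weylGroup.ofIdx P k := by
        rw [simpleReflection, ← h1, ofIdx_smul]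
        group
      rw [← h2]
      exact .inl ih

lemma bruhatLE_simpleReflection_mul {w : P.weylGroup} {i : b.support}
    (h : b.IsPos (w⁻¹ • (i : ι))) : BruhatLE b w (simpleReflection b i * w) :=
  .ofIdx_mul (length_lt_ofIdx_mul b (isPos_simple b i) h)

lemma BruhatLE.simpleReflection_mul {u w : P.weylGroup} {i : b.support} (h : BruhatLE b u w)
    (hi : b.IsPos (w⁻¹ • (i : ι))) :
    BruhatLE b (simpleReflection b i * u) (simpleReflection b i * w) :=
  (h.simpleReflection_mul_or i).elim (fun h => h.trans (bruhatLE_simpleReflection_mul hi)) id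

end WeylCombinatorics

/-! ### Inversion sets. -/

section Inversions

set_option linter.unusedSectionVars false

variable {ι X Y : Type*} [AddCommGroup X] [AddCommGroup Y] {P : RootDatum ι X Y}
  [Fintype ι] (b : P.Base)

lemma mem_inversions {w : P.weylGroup} {j : ι} :
    j ∈ inversions b w ↔ b.IsPos j ∧ ¬ b.IsPos (w⁻¹ • j) := by simp [inversions]

@[simp] lemma inversions_one : inversions b (1 : P.weylGroup) = ∅ := by
  ext j; simp [mem_inversions]

variable [P.IsReduced]

/-- When $s_iw$ is longer than $w$, $\Sigma_{s_iw}=\{\alpha_i\}\sqcup s_i\Sigma_w$. The product form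
yields both the cardinality of $\Sigma_w$ and the recursion for $c_w$. -/
lemma prod_inversions_simpleReflection_mul {M : Type*} [CommMonoid M] (F : ι → M)
    {i : b.support} {w : P.weylGroup} (h : b.IsPos (w⁻¹ • (i : ι))) :
    ∏ j ∈ inversions b (simpleReflection b i * w), F j =
      F i * ∏ j ∈ inversions b w, F (simpleReflection b i • j) := by
  classical
  have hmem : (i : ι) ∈ inversions b (simpleReflection b i * w) := by
    rw [mem_inversions, mul_inv_rev, mul_smul, simpleReflection_inv, simpleReflection_smul_self,
      smul_negIdx]
    simpa using ⟨isPos_simple b i, h⟩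
  have hss (j : ι) : simpleReflection b i • simpleReflection b i • j = j := by
    rw [← mul_smul, simpleReflection_mul_self, one_smul]
  rw [← Finset.mul_prod_erase _ _ hmem]
  congr 1
  refine Finset.prod_bij' (fun j _ => simpleReflection b i • j)
    (fun j _ => simpleReflection b i • j) ?_ ?_ (fun j _ => hss j) (fun j _ => hss j) ?_
  · intro j hj
    rw [Finset.mem_erase, mem_inversions, mul_inv_rev, mul_smul, simpleReflection_inv] at hj
    rw [mem_inversions]
    exact ⟨isPos_simpleReflection_smul b hj.2.1 hj.1, hj.2.2⟩
  · intro j hj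
    rw [mem_inversions] at hj
    have hji : j ≠ i := by rintro rfl; exact hj.2 h
    rw [Finset.mem_erase, mem_inversions, mul_inv_rev, mul_smul, simpleReflection_inv, hss]
    refine ⟨fun h' => ?_, isPos_simpleReflection_smul b hj.1 hji, hj.2⟩
    have h1 := hss j
    rw [h', simpleReflection_smul_self] at h1
    have := hj.1
    rw [← h1] at this
    simp [isPos_simple] at this
  · intro j _
    rw [hss]

lemma card_inversions (w : P.weylGroup) : (inversions b w).card = length b w := by
  induction w using weyl_induction_left b with
  | one => simp
  | mul i w h ih =>
    -- A product with every factor equal to the multiplicative copy of $1$ counts its factors.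
    have := prod_inversions_simpleReflection_mul b (fun _ => Multiplicative.ofAdd 1) h
    simp only [Finset.prod_const] at this
    rw [ih, ← pow_succ', ← ofAdd_nsmul, ← ofAdd_nsmul] at this
    rw [length_simpleReflection_mul b h]
    exact Multiplicative.ofAdd.injective (by simpa [ofAdd_add] using this)

/-! ### The longest element -/

lemma length_le_longest (w : P.weylGroup) : length b w ≤ length b (longest b) :=
  Classical.choose_spec (Finite.exists_max (length b)) w

/-- Positive roots are built by adding simple roots one at a time. Height is additive, so negative
heights on the images of the simple roots propagate. -/
lemma height_smul_neg_of_simple {w : P.weylGroup} (h : ∀ i : b.support, ¬ b.IsPos (w • (i : ι)))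
    {j : ι} (hj : b.IsPos j) : ¬ b.IsPos (w • j) := by
  have key : b.height (w • j) < 0 := by
    refine RootPairing.Base.IsPos.induction_on_add (p := fun j => b.height (w • j) < 0) hj
      (fun i hi => ?_) (fun i j k hk hi hj => ?_)
    · have h1 := h ⟨i, hi⟩
      have h2 := b.height_ne_zero (w • i)
      rw [RootPairing.Base.isPos_iff] at h1
      simp only at h1
      omega
    · have h1 := h ⟨j, hj⟩
      have h2 : P.root (w • k) = P.root (w • i) + P.root (w • j) := by
        simp only [root_smul_index, hk, smul_add]
      rw [RootPairing.Base.isPos_iff] at h1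
      simp only at h1
      rw [b.height_add h2]
      omega
  rw [RootPairing.Base.isPos_iff]
  omega

lemma not_isPos_longest_smul {j : ι} (hj : b.IsPos j) : ¬ b.IsPos (longest b • j) := by
  refine height_smul_neg_of_simple b (fun i hi => ?_) hj
  have := length_mul_simpleReflection b hi
  have := length_le_longest b (longest b * simpleReflection b i)
  omega

lemma not_isPos_longest_inv_smul {j : ι} (hj : b.IsPos j) : ¬ b.IsPos ((longest b)⁻¹ • j) := by
  refine height_smul_neg_of_simple b (fun i hi => ?_) hj
  have := length_simpleReflection_mul b hi
  have := length_le_longest b (simpleReflection b i * longest b)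
  omega

lemma isPos_longest_smul_iff {j : ι} : b.IsPos (longest b • j) ↔ ¬ b.IsPos j := by
  refine ⟨fun h h' => not_isPos_longest_smul b h' h, fun h => ?_⟩
  have := not_isPos_longest_smul b (j := negIdx P j) (by simpa using h)
  rw [smul_negIdx] at this
  simpa using this

lemma eq_one_of_forall_isPos {w : P.weylGroup} (h : ∀ j, b.IsPos j → b.IsPos (w⁻¹ • j)) :
    w = 1 := by
  apply eq_one_of_length_eq_zero b
  rw [← card_inversions, Finset.card_eq_zero, Finset.eq_empty_iff_forall_notMem]
  intro j hj
  rw [mem_inversions] at hj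
  exact hj.2 (h j hj.1)

/-- `longest` is just some element of maximal length. It reverses the sign of every root, so its
square has no inversions. -/
lemma longest_mul_self : longest b * longest b = 1 := by
  rw [← inv_eq_one]
  apply eq_one_of_forall_isPos b
  intro j hj
  rw [inv_inv, mul_smul, isPos_longest_smul_iff]
  exact not_isPos_longest_smul b hj

lemma longest_inv : (longest b)⁻¹ = longest b :=
  mul_eq_one_iff_inv_eq.mp (longest_mul_self b)

lemma inversions_longest : inversions b (longest b) = Finset.univ.filter fun j => b.IsPos j := by
  ext j
  simp only [mem_inversions, Finset.mem_filter, Finset.mem_univ, true_and, and_iff_left_iff_imp]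
  exact not_isPos_longest_inv_smul b

/-- Since $w_0$ reverses signs, a right multiplication that lengthens $w$ by one shortens $w_0w$ by
one. -/
lemma length_longest_mul_add (w : P.weylGroup) :
    length b (longest b * w) + length b w = length b (longest b) := by
  induction w using weyl_induction_right b with
  | one => simp
  | mul i w h ih =>
    have h1 : ¬ b.IsPos ((longest b * w) • (i : ι)) := by
      rw [mul_smul, isPos_longest_smul_iff, not_not]; exact h
    have h2 := length_mul_simpleReflection' b h1
    rw [length_mul_simpleReflection b h, ← mul_assoc]
    omega

lemma eq_longest_of_bruhatLE {w : P.weylGroup} (h : BruhatLE b (longest b) w) :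
    w = longest b := by
  rcases h.eq_or_length_lt with h | h
  · exact h.symm
  · exact absurd (length_le_longest b w) h.not_ge

end Inversions

/-- The alternating word `i, j, i, …` with `n` letters. -/
def altWord {α : Type*} (i j : α) : ℕ → List α
  | 0 => []
  | n + 1 => i :: altWord j i n

@[simp] lemma altWord_zero {α : Type*} (i j : α) : altWord i j 0 = [] := rfl

lemma altWord_succ {α : Type*} (i j : α) (n : ℕ) : altWord i j (n + 1) = i :: altWord j i n := rfl

@[simp] lemma length_altWord {α : Type*} (i j : α) (n : ℕ) : (altWord i j n).length = n := by
  induction n generalizing i j with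
  | zero => rfl
  | succ n ih => simp [altWord_succ, ih]

lemma take_altWord {α : Type*} (i j : α) {n k : ℕ} (h : n ≤ k) :
    (altWord i j k).take n = altWord i j n := by
  induction n generalizing i j k with
  | zero => simp
  | succ n ih =>
    obtain ⟨k, rfl⟩ := Nat.exists_eq_add_of_lt h
    rw [altWord_succ, List.take_succ_cons, ih _ _ (by omega),
      altWord_succ]

/-! ### Matsumoto's theorem. -/

section Matsumoto

set_option linter.unusedSectionVars false

variable {ι X Y : Type*} [AddCommGroup X] [AddCommGroup Y] {P : RootDatum ι X Y}
  [Finite ι] [P.IsReduced] {b : P.Base}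

/-- The exchange property puts $j$ in front and deletes one letter. If that letter lies after the
alternating prefix, the prefix has grown to one starting with $j$. If it lies inside, the deletion
is itself an equality of two alternating products, that is, a braid relation. -/
lemma altWord_exchange {i j : b.support} {k : ℕ} {r : List b.support} {w : P.weylGroup}
    (h : IsReducedWord b (altWord i j k ++ r) w) (hj : ¬ b.IsPos (w⁻¹ • (j : ι))) :
    (∃ n r', altWord i j k ++ r = altWord i j (n + 1) ++ r' ∧
      wordProd b (altWord i j (n + 1)) = wordProd b (altWord j i (n + 1))) ∨
    ∃ r', IsReducedWord b (altWord j i (k + 1) ++ r') w := by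
  obtain ⟨l₁, m, l₂, hl, hm⟩ := exists_letter_of_not_isPos b (altWord i j k ++ r) (isPos_simple b j)
    (by rwa [h.1])
  have hmul := ofIdx_mul_wordProd b hm
  have key (r₁ : List b.support) (h₁ : l₁ = altWord i j k ++ r₁) :
      ∃ r', IsReducedWord b (altWord j i (k + 1) ++ r') w := by
    refine ⟨r₁ ++ l₂, ?_, ?_⟩
    · rw [altWord_succ, List.cons_append, ← List.append_assoc, ← h₁, wordProd_cons,
        wordProd_append, ← mul_assoc]
      rw [hl] at h
      rw [← h.1, wordProd_append, wordProd_cons, ← mul_assoc, ← hmul]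
      rfl
    · rw [← h.2, hl, h₁]
      simp
      omega
  rcases List.append_eq_append_iff.mp hl with ⟨r₁, h₁, -⟩ | ⟨c, h₁, h₂⟩
  · exact .inr (key r₁ h₁)
  · cases c with
    | nil => exact .inr (key [] (by simpa using h₁.symm))
    | cons m' c =>
      obtain ⟨rfl, rfl⟩ : m = m' ∧ l₂ = c ++ r := by simpa using h₂
      have hk : k = l₁.length + (c.length + 1) := by
        have := congrArg List.length h₁
        simpa using this
      have e1 : l₁ = altWord i j l₁.length := by
        rw [← take_altWord i j (k := k) (by omega), h₁]
        simp
      have e2 : l₁ ++ [m] = altWord i j (l₁.length + 1) := by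
        rw [← take_altWord i j (k := k) (by omega), h₁, List.take_append]
        simp
      refine .inl ⟨l₁.length, c ++ r, ?_, ?_⟩
      · rw [hl, ← e2]; simp
      · rw [← e2, altWord_succ, ← e1, wordProd_append, wordProd_cons, wordProd_cons,
          wordProd_nil, mul_one, ← hmul]
        rfl

/-- Matsumoto's theorem: a family which satisfies the braid relations has the same product along
all reduced words of an element of the Weyl group. -/
theorem prod_map_eq_of_isReducedWord {M : Type*} [Monoid M] (φ : b.support → M)
    (hφ : ∀ i j n, i ≠ j → IsReducedWord b (altWord i j n) (wordProd b (altWord j i n)) →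
      ((altWord i j n).map φ).prod = ((altWord j i n).map φ).prod)
    {l l' : List b.support} {w : P.weylGroup} (hl : IsReducedWord b l w)
    (hl' : IsReducedWord b l' w) : (l.map φ).prod = (l'.map φ).prod := by
  induction hN : l.length using Nat.strong_induction_on generalizing l l' w with
  | _ N ih =>
  have hlen : l.length = l'.length := hl.2.trans hl'.2.symm
  -- Words with a common first letter reduce to shorter words, where the induction applies.
  have cons (i : b.support) (r r' : List b.support) (h : IsReducedWord b (i :: r) w)
      (h' : IsReducedWord b (i :: r') w) :
      ((i :: r).map φ).prod = ((i :: r').map φ).prod := by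
    have e : wordProd b r' = wordProd b r := by
      have := h'.1.trans h.1.symm
      simpa using this
    have h2 := h'.tail
    rw [e] at h2
    have hlt : r.length < N := by
      have := h.2.trans hl.2.symm
      simp at this
      omega
    simp [ih _ hlt h.tail h2 rfl]
  match l, l' with
  | [], [] => rfl
  | [], _ :: _ => simp at hlen
  | _ :: _, [] => simp at hlen
  | i :: l, j :: l' =>
    by_cases hij : i = j
    · subst hij; exact cons i l l' hl hl'
    have hi : ¬ b.IsPos (w⁻¹ • (i : ι)) := by
      have := hl.isPos_head
      rw [← hl.1, wordProd_cons, mul_inv_rev, mul_smul, simpleReflection_inv,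
        simpleReflection_smul_self, smul_negIdx]
      simpa using this
    have hj : ¬ b.IsPos (w⁻¹ • (j : ι)) := by
      have := hl'.isPos_head
      rw [← hl'.1, wordProd_cons, mul_inv_rev, mul_smul, simpleReflection_inv,
        simpleReflection_smul_self, smul_negIdx]
      simpa using this
    -- One braid move on a word beginning with $i,j,\dots$ gives one beginning with $j,i,\dots$;
    -- each end is compared with a given word having the same first letter.
    have swap {i j : b.support} (hij : i ≠ j) {n k : ℕ} {r r' s s' : List b.support}
        (hs : IsReducedWord b (i :: s) w) (hs' : IsReducedWord b (j :: s') w)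
        (h : IsReducedWord b (altWord i j (k + 1) ++ r) w)
        (e : altWord i j (k + 1) ++ r = altWord i j (n + 1) ++ r')
        (hw : wordProd b (altWord i j (n + 1)) = wordProd b (altWord j i (n + 1))) :
        ((i :: s).map φ).prod = ((j :: s').map φ).prod := by
      have h1 : IsReducedWord b (altWord i j (n + 1) ++ r') w := e ▸ h
      have h2 : IsReducedWord b (altWord j i (n + 1) ++ r') w := by
        refine ⟨?_, by simpa using h1.2⟩
        rw [wordProd_append, ← hw, ← wordProd_append, h1.1]
      have h3 := hφ i j (n + 1) hij (hw ▸ h1.of_append_left)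
      have h4 : ((altWord i j (n + 1) ++ r').map φ).prod = ((altWord j i (n + 1) ++ r').map φ).prod := by
        simp [h3]
      rw [altWord_succ, List.cons_append] at h1 h4
      rw [cons i s _ hs h1, h4]
      rw [altWord_succ, List.cons_append] at h2 ⊢
      exact (cons j s' _ hs' h2).symm
    -- Either a braid move settles the equality, or $w$ has reduced words with alternating prefixes
    -- of length $k+1$ in both orders. At $k=N$ such a prefix is longer than $w$.
    have claim (k : ℕ) : (((i :: l).map φ).prod = ((j :: l').map φ).prod) ∨
        (∃ r, IsReducedWord b (altWord i j (k + 1) ++ r) w) ∧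
        ∃ r, IsReducedWord b (altWord j i (k + 1) ++ r) w := by
      induction k with
      | zero => exact .inr ⟨⟨l, hl⟩, ⟨l', hl'⟩⟩
      | succ k ihk =>
        rcases ihk with h | ⟨⟨r, hr⟩, ⟨r', hr'⟩⟩
        · exact .inl h
        rcases altWord_exchange hr hj with ⟨n, s, e, hw⟩ | h1
        · exact .inl (swap hij hl hl' hr e hw)
        rcases altWord_exchange hr' hi with ⟨n, s, e, hw⟩ | h2
        · exact .inl (swap (Ne.symm hij) hl' hl hr' e hw).symm
        exact .inr ⟨h2, h1⟩
    rcases claim N with h | ⟨⟨r, hr⟩, -⟩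
    · exact h
    · have := hr.2.trans hl.2.symm
      simp at this hN
      omega

end Matsumoto

/-! ### Braid relations in a dihedral crossed product -/

section DihedralBraid

variable {F A : Type*} [CommRing F] [Ring A] [Module F A] [IsScalarTower F A A]
  {s t : A} {σ θ : F →+* F} {κ μ : F}

/-- The combination with coefficients `x` of the 6 elements of a dihedral group of order 6. -/
def dihedralComb6 (s t : A) (x : Fin 6 → F) : A :=
  x 0 • 1 + x 1 • s + x 2 • t + x 3 • (s * t) + x 4 • (t * s) + x 5 • (s * (t * s))

lemma mul_dihedralComb6_left (h : ∀ x w, s * (x • w) = σ x • (s * w))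
    (h' : ∀ w, s * (s * w) = κ • w) (p : F) (x : Fin 6 → F) :
    (p • 1 + s) * dihedralComb6 s t x = dihedralComb6 s t ![
      p * x 0 + σ (x 1) * κ, p * x 1 + σ (x 0), p * x 2 + σ (x 3) * κ, p * x 3 + σ (x 2),
      p * x 4 + σ (x 5) * κ, p * x 5 + σ (x 4)] := by
  have h1 : s * s = κ • 1 := by simpa using h' 1
  simp only [dihedralComb6, add_mul, smul_mul_assoc, one_mul, mul_add, h, h', h1, mul_one]
  simp
  module

lemma mul_dihedralComb6_right (h : ∀ x w, t * (x • w) = θ x • (t * w))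
    (h' : ∀ w, t * (t * w) = μ • w)
    (hst : s * (t * s) = t * (s * t)) (p : F) (x : Fin 6 → F) :
    (p • 1 + t) * dihedralComb6 s t x = dihedralComb6 s t ![
      p * x 0 + θ (x 2) * μ, p * x 1 + θ (x 4) * μ, p * x 2 + θ (x 0), p * x 3 + θ (x 5) * μ,
      p * x 4 + θ (x 1), p * x 5 + θ (x 3)] := by
  have h1 : t * t = μ • 1 := by simpa using h' 1
  simp only [dihedralComb6, add_mul, smul_mul_assoc, one_mul, mul_add, h, h', h1, mul_one, hst]
  simp
  module

/-- Here $p_1,p_2,p_3$ stand for $d(\alpha_i),d(\alpha_i+\alpha_j),d(\alpha_j)$, $Q$ for $q-1$, and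
$s,t$ for intertwiners. Both sides are expanded over the six normal forms; comparing coefficients
leaves polynomial identities that follow from `h0`, the addition formula for $d$. -/
lemma braid_three (Q p₁ p₂ p₃ : F)
    (hs : ∀ x w, s * (x • w) = σ x • (s * w)) (ht : ∀ x w, t * (x • w) = θ x • (t * w))
    (hss : ∀ w, s * (s * w) = (1 + Q + p₁ * (Q - p₁)) • w)
    (htt : ∀ w, t * (t * w) = (1 + Q + p₃ * (Q - p₃)) • w)
    (hst : s * (t * s) = t * (s * t))
    (hσ1 : σ p₁ = Q - p₁) (hσ2 : σ p₂ = p₃) (hσ3 : σ p₃ = p₂) (hθ1 : θ p₁ = p₂) (hθ2 : θ p₂ = p₁)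
    (hθ3 : θ p₃ = Q - p₃) (h0 : p₂ * (Q - p₁ - p₃) + p₁ * p₃ = 0) :
    (p₁ • 1 + s) * ((p₃ • 1 + t) * (p₁ • 1 + s)) =
      (p₃ • 1 + t) * ((p₁ • 1 + s) * (p₃ • 1 + t)) := by
  have e1 : p₁ • 1 + s = dihedralComb6 s t ![p₁, 1, 0, 0, 0, 0] := by simp [dihedralComb6]
  have e2 : p₃ • 1 + t = dihedralComb6 s t ![p₃, 0, 1, 0, 0, 0] := by simp [dihedralComb6]
  have S (x : Fin 6 → F) := mul_dihedralComb6_left (t := t) hs hss p₁ x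
  have T (x : Fin 6 → F) := mul_dihedralComb6_right ht htt hst p₃ x
  conv_lhs => enter [2,2]; rw [e1]
  conv_rhs => enter [2,2]; rw [e2]
  simp only [S, T]
  congr 1
  simp only [Matrix.cons_val, map_mul, map_one, map_zero, hσ1, hσ2, hσ3, hθ1, hθ2, hθ3, mul_zero,
    zero_mul, add_zero, zero_add, mul_one]
  ext i
  fin_cases i <;> simp only [Fin.mk_zero, Fin.mk_one, Fin.reduceFinMk, Matrix.cons_val]
  all_goals grind

/-- The combination with coefficients `x` of the 8 elements of a dihedral group of order 8. -/
def dihedralComb8 (s t : A) (x : Fin 8 → F) : A :=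
  x 0 • 1 + x 1 • s + x 2 • t + x 3 • (s * t) + x 4 • (t * s) + x 5 • (s * (t * s)) +
  x 6 • (t * (s * t)) + x 7 • (s * (t * (s * t)))

lemma mul_dihedralComb8_left (h : ∀ x w, s * (x • w) = σ x • (s * w))
    (h' : ∀ w, s * (s * w) = κ • w) (p : F) (x : Fin 8 → F) :
    (p • 1 + s) * dihedralComb8 s t x = dihedralComb8 s t ![
      p * x 0 + σ (x 1) * κ, p * x 1 + σ (x 0), p * x 2 + σ (x 3) * κ, p * x 3 + σ (x 2),
      p * x 4 + σ (x 5) * κ, p * x 5 + σ (x 4), p * x 6 + σ (x 7) * κ, p * x 7 + σ (x 6)] := by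
  have h1 : s * s = κ • 1 := by simpa using h' 1
  simp only [dihedralComb8, add_mul, smul_mul_assoc, one_mul, mul_add, h, h', h1, mul_one]
  simp
  module

lemma mul_dihedralComb8_right (h : ∀ x w, t * (x • w) = θ x • (t * w))
    (h' : ∀ w, t * (t * w) = μ • w)
    (hst : s * (t * (s * t)) = t * (s * (t * s))) (p : F) (x : Fin 8 → F) :
    (p • 1 + t) * dihedralComb8 s t x = dihedralComb8 s t ![
      p * x 0 + θ (x 2) * μ, p * x 1 + θ (x 4) * μ, p * x 2 + θ (x 0), p * x 3 + θ (x 6) * μ,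
      p * x 4 + θ (x 1), p * x 5 + θ (x 7) * μ, p * x 6 + θ (x 3), p * x 7 + θ (x 5)] := by
  have h1 : t * t = μ • 1 := by simpa using h' 1
  simp only [dihedralComb8, add_mul, smul_mul_assoc, one_mul, mul_add, h, h', h1, mul_one, hst]
  simp
  module

/-- The $p$'s stand for $d$ at $\alpha_i,\ 2\alpha_i+\alpha_j,\ \alpha_i+\alpha_j,\ \alpha_j$; `h0`
and `h1` are addition formulas for the two non-simple roots. -/
lemma braid_four (Q p₁ p₂ p₃ p₄ : F)
    (hs : ∀ x w, s * (x • w) = σ x • (s * w)) (ht : ∀ x w, t * (x • w) = θ x • (t * w))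
    (hss : ∀ w, s * (s * w) = (1 + Q + p₁ * (Q - p₁)) • w)
    (htt : ∀ w, t * (t * w) = (1 + Q + p₄ * (Q - p₄)) • w)
    (hst : s * (t * (s * t)) = t * (s * (t * s)))
    (hσ : σ Q = Q) (hθ : θ Q = Q)
    (hσ1 : σ p₁ = Q - p₁) (hσ2 : σ p₂ = p₄) (hσ3 : σ p₃ = p₃) (hσ4 : σ p₄ = p₂) (hθ1 : θ p₁ = p₃)
    (hθ2 : θ p₂ = p₂) (hθ3 : θ p₃ = p₁) (hθ4 : θ p₄ = Q - p₄)
    (h0 : p₂ * (Q - p₁ - p₃) + p₁ * p₃ = 0) (h1 : p₃ * (Q - p₁ - p₄) + p₁ * p₄ = 0) :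
    (p₁ • 1 + s) * ((p₄ • 1 + t) * ((p₁ • 1 + s) * (p₄ • 1 + t))) =
      (p₄ • 1 + t) * ((p₁ • 1 + s) * ((p₄ • 1 + t) * (p₁ • 1 + s))) := by
  have e1 : p₁ • 1 + s = dihedralComb8 s t ![p₁, 1, 0, 0, 0, 0, 0, 0] := by simp [dihedralComb8]
  have e2 : p₄ • 1 + t = dihedralComb8 s t ![p₄, 0, 1, 0, 0, 0, 0, 0] := by simp [dihedralComb8]
  have S (x : Fin 8 → F) := mul_dihedralComb8_left (t := t) hs hss p₁ x
  have T (x : Fin 8 → F) := mul_dihedralComb8_right ht htt hst p₄ x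
  conv_lhs => enter [2,2,2]; rw [e2]
  conv_rhs => enter [2,2,2]; rw [e1]
  simp only [S, T]
  congr 1
  simp only [Matrix.cons_val, map_add, map_mul, map_sub, map_one, map_zero, hσ, hθ, hσ1, hσ2,
    hσ3, hσ4, hθ1, hθ2, hθ3, hθ4, mul_zero, zero_mul, add_zero, zero_add, mul_one]
  ext i
  fin_cases i <;> simp only [Fin.mk_zero, Fin.mk_one, Fin.reduceFinMk, Matrix.cons_val]
  all_goals grind

/-- The combination with coefficients `x` of the 12 elements of a dihedral group of order 12. -/
def dihedralComb12 (s t : A) (x : Fin 12 → F) : A :=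
  x 0 • 1 + x 1 • s + x 2 • t + x 3 • (s * t) + x 4 • (t * s) + x 5 • (s * (t * s)) +
  x 6 • (t * (s * t)) + x 7 • (s * (t * (s * t))) + x 8 • (t * (s * (t * s))) +
  x 9 • (s * (t * (s * (t * s)))) + x 10 • (t * (s * (t * (s * t)))) +
  x 11 • (s * (t * (s * (t * (s * t)))))

lemma mul_dihedralComb12_left (h : ∀ x w, s * (x • w) = σ x • (s * w))
    (h' : ∀ w, s * (s * w) = κ • w) (p : F) (x : Fin 12 → F) :
    (p • 1 + s) * dihedralComb12 s t x = dihedralComb12 s t ![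
      p * x 0 + σ (x 1) * κ, p * x 1 + σ (x 0), p * x 2 + σ (x 3) * κ, p * x 3 + σ (x 2),
      p * x 4 + σ (x 5) * κ, p * x 5 + σ (x 4), p * x 6 + σ (x 7) * κ, p * x 7 + σ (x 6),
      p * x 8 + σ (x 9) * κ, p * x 9 + σ (x 8), p * x 10 + σ (x 11) * κ, p * x 11 + σ (x 10)] := by
  have h1 : s * s = κ • 1 := by simpa using h' 1
  simp only [dihedralComb12, add_mul, smul_mul_assoc, one_mul, mul_add, h, h', h1, mul_one]
  simp
  module

lemma mul_dihedralComb12_right (h : ∀ x w, t * (x • w) = θ x • (t * w))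
    (h' : ∀ w, t * (t * w) = μ • w)
    (hst : s * (t * (s * (t * (s * t)))) = t * (s * (t * (s * (t * s))))) (p : F) (x : Fin 12 → F) :
    (p • 1 + t) * dihedralComb12 s t x = dihedralComb12 s t ![
      p * x 0 + θ (x 2) * μ, p * x 1 + θ (x 4) * μ, p * x 2 + θ (x 0), p * x 3 + θ (x 6) * μ,
      p * x 4 + θ (x 1), p * x 5 + θ (x 8) * μ, p * x 6 + θ (x 3), p * x 7 + θ (x 10) * μ,
      p * x 8 + θ (x 5), p * x 9 + θ (x 11) * μ, p * x 10 + θ (x 7), p * x 11 + θ (x 9)] := by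
  have h1 : t * t = μ • 1 := by simpa using h' 1
  simp only [dihedralComb12, add_mul, smul_mul_assoc, one_mul, mul_add, h, h', h1, mul_one, hst]
  simp
  module

/-- The $p$'s stand for $d$ at the positive roots $(1,0),(3,1),(2,1),(3,2),(1,1),(0,1)$ in
coordinates $(\alpha_i,\alpha_j)$. The last five hypotheses come from decompositions of one of these
roots as a sum of two others. -/
lemma braid_six (Q p₁ p₂ p₃ p₄ p₅ p₆ : F)
    (hs : ∀ x w, s * (x • w) = σ x • (s * w)) (ht : ∀ x w, t * (x • w) = θ x • (t * w))
    (hss : ∀ w, s * (s * w) = (1 + Q + p₁ * (Q - p₁)) • w)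
    (htt : ∀ w, t * (t * w) = (1 + Q + p₆ * (Q - p₆)) • w)
    (hst : s * (t * (s * (t * (s * t)))) = t * (s * (t * (s * (t * s)))))
    (hσ : σ Q = Q) (hθ : θ Q = Q)
    (hσ1 : σ p₁ = Q - p₁) (hσ2 : σ p₂ = p₆) (hσ3 : σ p₃ = p₅) (hσ4 : σ p₄ = p₄) (hσ5 : σ p₅ = p₃)
    (hσ6 : σ p₆ = p₂) (hθ1 : θ p₁ = p₅) (hθ2 : θ p₂ = p₄) (hθ3 : θ p₃ = p₃) (hθ4 : θ p₄ = p₂)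
    (hθ5 : θ p₅ = p₁) (hθ6 : θ p₆ = Q - p₆) (h0 : p₂ * (Q - p₁ - p₃) + p₁ * p₃ = 0)
    (h1 : p₃ * (Q - p₁ - p₅) + p₁ * p₅ = 0) (h2 : p₄ * (Q - p₃ - p₅) + p₃ * p₅ = 0)
    (h3 : p₄ * (Q - p₂ - p₆) + p₂ * p₆ = 0) (h4 : p₅ * (Q - p₁ - p₆) + p₁ * p₆ = 0) :
    (p₁ • 1 + s) * ((p₆ • 1 + t) * ((p₁ • 1 + s) * ((p₆ • 1 + t) * ((p₁ • 1 + s) *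
      (p₆ • 1 + t))))) =
      (p₆ • 1 + t) * ((p₁ • 1 + s) * ((p₆ • 1 + t) * ((p₁ • 1 + s) * ((p₆ • 1 + t) *
      (p₁ • 1 + s))))) := by
  have e1 : p₁ • 1 + s = dihedralComb12 s t ![p₁, 1, 0, 0, 0, 0, 0, 0, 0, 0, 0, 0] := by simp [dihedralComb12]
  have e2 : p₆ • 1 + t = dihedralComb12 s t ![p₆, 0, 1, 0, 0, 0, 0, 0, 0, 0, 0, 0] := by simp [dihedralComb12]
  have S (x : Fin 12 → F) := mul_dihedralComb12_left (t := t) hs hss p₁ x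
  have T (x : Fin 12 → F) := mul_dihedralComb12_right ht htt hst p₆ x
  conv_lhs => enter [2,2,2,2,2]; rw [e2]
  conv_rhs => enter [2,2,2,2,2]; rw [e1]
  simp only [S, T]
  congr 1
  simp only [Matrix.cons_val, map_add, map_mul, map_sub, map_one, map_zero, hσ, hθ, hσ1, hσ2,
    hσ3, hσ4, hσ5, hσ6, hθ1, hθ2, hθ3, hθ4, hθ5, hθ6, mul_zero, zero_mul, add_zero, zero_add,
    mul_one]
  ext i
  fin_cases i <;> simp only [Fin.mk_zero, Fin.mk_one, Fin.reduceFinMk, Matrix.cons_val]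
  all_goals grind

lemma braid_two (p₁ p₂ : F) (hs : ∀ x w, s * (x • w) = σ x • (s * w))
    (ht : ∀ x w, t * (x • w) = θ x • (t * w)) (hst : s * t = t * s) (hσ : σ p₂ = p₂)
    (hθ : θ p₁ = p₁) :
    (p₁ • 1 + s) * (p₂ • 1 + t) = (p₂ • 1 + t) * (p₁ • 1 + s) := by
  simp only [add_mul, mul_add, smul_mul_assoc, one_mul, hs, ht, hσ, hθ, mul_one, hst]
  module

end DihedralBraid

/-! ### Computations in $Q$: monomials, nonvanishing, and the constants $d$. -/

section Scalars

variable {X : Type*} [AddCommGroup X] [Module.Free ℤ X]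

lemma algebraMap_single_inj {x y : X} {r s : CoeffRing} (hr : r ≠ 0)
    (h : algebraMap (LatticeRing X) (FracField X) (AddMonoidAlgebra.single x r) =
      algebraMap (LatticeRing X) (FracField X) (AddMonoidAlgebra.single y s)) : x = y ∧ r = s := by
  have h1 := IsFractionRing.injective (LatticeRing X) (FracField X) h
  have h2 := (Finsupp.single_eq_single_iff x y r s).mp (congrArg AddMonoidAlgebra.coeff h1)
  tauto

lemma qHalf_eq (n : ℤ) : qHalf X n =
    algebraMap (LatticeRing X) (FracField X) (AddMonoidAlgebra.single 0 (LaurentPolynomial.T n)) := by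
  rw [qHalf, IsScalarTower.algebraMap_apply CoeffRing (LatticeRing X) (FracField X)]
  rfl

lemma qHalf_add (m n : ℤ) : qHalf X (m + n) = qHalf X m * qHalf X n := by
  rw [qHalf, LaurentPolynomial.T_add, map_mul]; rfl

@[simp] lemma qHalf_zero : qHalf X 0 = 1 := by simp [qHalf]

lemma q_pow (n : ℕ) : q X ^ n = qHalf X (2 * n) := by
  induction n with
  | zero => simp
  | succ n ih => rw [pow_succ, ih, q, ← qHalf_add]; congr 1

@[simp] lemma ex_zero : ex (0 : X) = 1 := by simp [ex, ← AddMonoidAlgebra.one_def]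

lemma ex_add (x y : X) : ex (x + y) = ex x * ex y := by
  simp [ex, ← map_mul, AddMonoidAlgebra.single_mul_single]

lemma ex_mul_ex_neg (x : X) : ex x * ex (-x) = 1 := by rw [← ex_add]; simp

lemma ex_ne_zero (x : X) : ex x ≠ 0 := left_ne_zero_of_mul_eq_one (ex_mul_ex_neg x)

lemma ex_neg (x : X) : ex (-x) = (ex x)⁻¹ := eq_inv_of_mul_eq_one_right (ex_mul_ex_neg x)

lemma qHalf_mul_ex_eq (n : ℤ) (x : X) : qHalf X n * ex x =
    algebraMap (LatticeRing X) (FracField X) (AddMonoidAlgebra.single x (LaurentPolynomial.T n)) := by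
  simp [qHalf_eq, ex, ← map_mul, AddMonoidAlgebra.single_mul_single]

lemma T_ne_zero (n : ℤ) : (LaurentPolynomial.T n : CoeffRing) ≠ 0 :=
  (LaurentPolynomial.isUnit_T n).ne_zero

/-- Distinct monomials $q^{n/2}e^x$ are distinct basis elements of $S$, which embeds in $Q$. This is
the source of the nonvanishing of $x_\alpha$, $\tilde x_\alpha$ and $\hat x_\alpha$. -/
lemma qHalf_mul_ex_inj {m n : ℤ} {x y : X} (h : qHalf X m * ex x = qHalf X n * ex y) :
    m = n ∧ x = y := by
  rw [qHalf_mul_ex_eq, qHalf_mul_ex_eq] at h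
  have := algebraMap_single_inj (T_ne_zero m) h
  refine ⟨?_, this.1⟩
  have h2 := (Finsupp.single_eq_single_iff _ _ _ _).mp (congrArg AddMonoidAlgebra.coeff this.2)
  simpa using h2

lemma ex_ne_one {x : X} (hx : x ≠ 0) : ex x ≠ 1 := fun h =>
  hx (qHalf_mul_ex_inj (m := 0) (n := 0) (y := 0) (by simpa using h)).2

lemma q_ne_ex (x : X) : q X ≠ ex x := fun h => by
  have := (qHalf_mul_ex_inj (m := 2) (n := 0) (x := 0) (y := x) (by simpa [q] using h)).1
  omega

lemma xx_ne_zero {x : X} (hx : x ≠ 0) : xx x ≠ 0 :=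
  sub_ne_zero.mpr (ex_ne_one (neg_ne_zero.mpr hx)).symm

lemma xTilde_ne_zero (x : X) : xTilde x ≠ 0 := sub_ne_zero.mpr (q_ne_ex x)

lemma xHat_ne_zero (x : X) : xHat x ≠ 0 := by
  intro h
  refine q_ne_ex x ?_
  have h1 := ex_mul_ex_neg x
  have h2 : 1 - q X * ex (-x) = 0 := h
  linear_combination (-ex x) * h2 - q X * h1

/-- The constant term `(q - 1) / x_{-λ}` of the Demazure–Lusztig elements. -/
def dlConst (x : X) : FracField X := (q X - 1) / xx (-x)

/-- This is $\frac1{1-e^{x}}+\frac1{1-e^{-x}}=1$, multiplied by $q-1$. -/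
lemma dlConst_neg {x : X} (hx : x ≠ 0) : dlConst (-x) = q X - 1 - dlConst x := by
  have h1 := xx_ne_zero hx
  have h2 := xx_ne_zero (neg_ne_zero.mpr hx)
  have h3 := ex_mul_ex_neg x
  rw [dlConst, dlConst, neg_neg]
  field_simp
  simp only [xx, neg_neg] at *
  linear_combination (1 - q X) * h3

/-- A rational identity in the two variables $e^x,e^y$. It is the only relation between constants at
non-proportional roots that the braid relations need. -/
lemma dlConst_add {x y : X} (hx : x ≠ 0) (hy : y ≠ 0) (hxy : x + y ≠ 0) :
    dlConst (x + y) * (q X - 1 - dlConst x - dlConst y) + dlConst x * dlConst y = 0 := by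
  have h1 := xx_ne_zero (neg_ne_zero.mpr hx)
  have h2 := xx_ne_zero (neg_ne_zero.mpr hy)
  have h3 := xx_ne_zero (neg_ne_zero.mpr hxy)
  simp only [dlConst]
  field_simp
  simp only [xx, neg_neg, ex_add] at *
  ring

end Scalars

/-! ### The Weyl group action on scalars and the product of $Q_W$. -/

section Action

variable {ι X Y : Type*} [AddCommGroup X] [AddCommGroup Y] [Module.Free ℤ X]
  {P : RootDatum ι X Y}

lemma smul_qHalf (w : P.weylGroup) (n : ℤ) : w • qHalf X n = qHalf X n :=
  smul_algebraMap_coeffRing w _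

@[simp] lemma smul_q (w : P.weylGroup) : w • q X = q X := smul_qHalf w 2

lemma smul_xx (w : P.weylGroup) (x : X) : w • xx x = xx (w • x) := by
  rw [xx, smul_sub, smul_one, smul_ex, smul_neg, xx]

lemma smul_xTilde (w : P.weylGroup) (x : X) : w • xTilde x = xTilde (w • x) := by
  rw [xTilde, smul_sub, smul_q, smul_ex, xTilde]

lemma smul_xHat (w : P.weylGroup) (x : X) : w • xHat x = xHat (w • x) := by
  rw [xHat, smul_sub, smul_one, smul_mul', smul_q, smul_ex, smul_neg, xHat]

lemma smul_div_fracField (w : P.weylGroup) (x y : FracField X) : w • (x / y) = w • x / w • y :=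
  map_div₀ (MulSemiringAction.toRingHom P.weylGroup (FracField X) w) x y

lemma smul_dlConst (w : P.weylGroup) (x : X) : w • dlConst x = dlConst (w • x) := by
  rw [dlConst, smul_div_fracField, smul_sub, smul_one, smul_q, smul_xx, smul_neg, dlConst]

lemma δ_one : (δ 1 : TwistedAlgebra P) = 1 := rfl

lemma δ_mul_δ (u v : P.weylGroup) : (δ u * δ v : TwistedAlgebra P) = δ (u * v) := by
  simp [δ, SkewMonoidAlgebra.single_mul_single]

lemma δ_mul_smul (w : P.weylGroup) (x : FracField X) (z : TwistedAlgebra P) :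
    δ w * (x • z) = (w • x) • (δ w * z) := by
  refine SkewMonoidAlgebra.ext fun v => ?_
  simp [δ, smul_mul']

end Action

/-! ### Rank two -/

section RankTwo

set_option linter.unusedSectionVars false

variable {ι X Y : Type*} [AddCommGroup X] [AddCommGroup Y] {P : RootDatum ι X Y}
  [Finite ι] [P.IsReduced] {b : P.Base}

lemma simpleReflection_smul (i : b.support) (z : X) :
    simpleReflection b i • z = z - P.coroot' i z • P.root i :=
  P.reflection_apply i z

lemma coroot'_root_eq (i : b.support) {j : b.support} {n : ℤ}
    (h : P.pairingIn ℤ j i = -n) : P.coroot' i (P.root j) = -n := by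
  rw [← h]
  have := P.algebraMap_pairingIn ℤ j i
  simpa using this.symm

/-- The translate by $z$ allows words in $s_i,s_j$ to be evaluated on all of $X$, which the two
roots need not span. -/
lemma simpleReflection_smul_comb (i j : b.support) {x : ℤ} (hx : P.pairingIn ℤ j i = -x)
    (z : X) (k l : ℤ) :
    simpleReflection b i • (z + k • P.root i + l • P.root j) =
      z + (x * l - k - P.coroot' i z) • P.root i + l • P.root j := by
  rw [simpleReflection_smul]
  simp only [map_add, map_zsmul, coroot'_root_eq i hx, RootPairing.root_coroot'_eq_pairing,
    RootPairing.pairing_same, smul_eq_mul]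
  module

lemma isPos_of_root_eq {i j : b.support} (hij : i ≠ j) {β : ι} {k l : ℤ} (hk : 0 ≤ k) (hl : 0 ≤ l)
    (h : P.root β = k • P.root i + l • P.root j) : b.IsPos β := by
  classical
  have hij' : (i : ι) ≠ j := fun h => hij (Subtype.ext h)
  have h1 : P.root β = ∑ m ∈ b.support, (Pi.single (i : ι) k + Pi.single (j : ι) l : ι → ℤ) m •
      P.root m := by
    simp [Pi.single_apply, add_smul, Finset.sum_add_distrib, ite_smul, h]
  rw [RootPairing.Base.isPos_iff', b.height_eq_sum h1]
  simp [Finset.sum_add_distrib, Pi.single_apply]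
  omega

/-- If the two alternating words of length $m+1$ agree, then in one of length $m+2$ the last two
letters cancel after the exchange, leaving $m$ letters. Reduced alternating words are thus no longer
than $m+1$. -/
lemma altWord_length_le {i j : b.support} {m n : ℕ}
    (h : IsReducedWord b (altWord i j n) (wordProd b (altWord j i n)))
    (hm : wordProd b (altWord i j (m + 1)) = wordProd b (altWord j i (m + 1))) : n ≤ m + 1 := by
  by_contra hn
  have key : ∀ (i j : b.support) (m : ℕ), ∃ k, altWord i j (m + 1) = altWord i j m ++ [k] ∧
      altWord j i (m + 2) = altWord j i (m + 1) ++ [k] := by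
    intro i j m
    induction m generalizing i j with
    | zero => exact ⟨i, rfl, rfl⟩
    | succ m ih =>
      obtain ⟨k, h1, h2⟩ := ih j i
      refine ⟨k, ?_, ?_⟩
      · rw [altWord_succ i j (m + 1), h1, altWord_succ]; rfl
      · rw [altWord_succ j i (m + 2), h2, altWord_succ]; rfl
  obtain ⟨k, h1, h2⟩ := key j i m
  have hsplit : altWord i j n = altWord i j (m + 2) ++ (altWord i j n).drop (m + 2) := by
    rw [← take_altWord i j (n := m + 2) (k := n) (by omega), List.take_append_drop]
  rw [hsplit] at h
  have h3 := h.of_append_left.2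
  have h4 : wordProd b (altWord i j (m + 2)) = wordProd b (altWord j i m) := by
    rw [h2, wordProd_append, hm, h1, wordProd_append, mul_assoc]
    simp [simpleReflection_mul_self]
  have h5 := length_wordProd_le b (altWord j i m)
  rw [h4] at h3
  simp at h3 h5
  omega

lemma not_isPos_altWord {i j : b.support} {n : ℕ}
    (h : IsReducedWord b (altWord i j (n + 1)) (wordProd b (altWord j i (n + 1)))) :
    ¬ b.IsPos ((wordProd b (altWord i j (n + 1)))⁻¹ • (j : ι)) := by
  rw [h.1]
  have h1 : IsReducedWord b (altWord j i (n + 1)) (wordProd b (altWord j i (n + 1))) :=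
    ⟨rfl, by rw [← h.2]; simp⟩
  have := h1.isPos_head
  rw [altWord_succ, wordProd_cons, mul_inv_rev, mul_smul, simpleReflection_inv,
    simpleReflection_smul_self, smul_negIdx]
  simpa using this

/-- Pins down the length of a reduced braid relation without computing the order of $s_is_j$. It is
at most $m+1$ by cancellation, and a shorter one would force $\alpha_j$ to become negative too
early. -/
lemma eq_of_isReducedWord_altWord {i j : b.support} {m n : ℕ} (hn : n ≠ 0)
    (h : IsReducedWord b (altWord i j n) (wordProd b (altWord j i n)))
    (hm : wordProd b (altWord i j (m + 1)) = wordProd b (altWord j i (m + 1)))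
    (hpos : ∀ k, k < m → b.IsPos ((wordProd b (altWord i j (k + 1)))⁻¹ • (j : ι))) : n = m + 1 := by
  have h1 := altWord_length_le h hm
  obtain ⟨k, rfl⟩ := Nat.exists_eq_succ_of_ne_zero hn
  by_contra h2
  exact not_isPos_altWord h (hpos k (by omega))

section

variable {i j : b.support}

lemma wordProd_altWord_eq_of_forall {l m : List b.support}
    (h : ∀ x : X, wordProd b l • x = wordProd b m • x) : wordProd b l = wordProd b m := by
  apply Subtype.ext
  apply RootPairing.Equiv.weightHom_injective P
  ext x
  exact h x

lemma root_comb_smul {i j : b.support} {x y : ℤ} (hx : P.pairingIn ℤ j i = -x)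
    (hy : P.pairingIn ℤ i j = -y) (k l : ℤ) :
    simpleReflection b i • (k • P.root i + l • P.root j) =
      (x * l - k) • P.root i + l • P.root j ∧
    simpleReflection b j • (k • P.root i + l • P.root j) =
      k • P.root i + (y * k - l) • P.root j := by
  constructor
  · simpa using simpleReflection_smul_comb i j hx 0 k l
  · have := simpleReflection_smul_comb j i hy 0 l k
    rw [zero_add] at this
    rw [add_comm, this, map_zero]
    module

/-- The four cases are $A_1\times A_1$, $A_2$, $B_2$ and $G_2$, whose braid relations have length
$m+1=2,3,4,6$. -/
lemma altWord_isPos {i j : b.support} (hij : i ≠ j) {x y : ℤ} (hx : P.pairingIn ℤ j i = -x)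
    (hy : P.pairingIn ℤ i j = -y) {m : ℕ}
    (hm : (x, y, m) = (0, 0, 1) ∨ (x, y, m) = (1, 1, 2) ∨ (x, y, m) = (2, 1, 3) ∨
      (x, y, m) = (3, 1, 5)) (k : ℕ) (hk : k < m) :
    b.IsPos ((wordProd b (altWord i j (k + 1)))⁻¹ • (j : ι)) := by
  have R (k l : ℤ) := (root_comb_smul hx hy k l).1
  have S (k l : ℤ) := (root_comb_smul hx hy k l).2
  have h0 : P.root (j : ι) = (0 : ℤ) • P.root i + (1 : ℤ) • P.root j := by simp
  -- The coordinates $u,v$ of the image root are left open and found by unification when the word is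
  -- evaluated on $\alpha_j$.
  have key (u v : ℤ) (hu : 0 ≤ u) (hv : 0 ≤ v)
      (h : ∀ z : X, z = (0 : ℤ) • P.root i + (1 : ℤ) • P.root j →
        (wordProd b (altWord i j (k + 1)))⁻¹ • z = u • P.root i + v • P.root j) :
      b.IsPos ((wordProd b (altWord i j (k + 1)))⁻¹ • (j : ι)) :=
    isPos_of_root_eq hij hu hv (by rw [root_smul_index, h _ h0])
  rcases hm with h | h | h | h <;> obtain ⟨rfl, rfl, rfl⟩ : _ ∧ _ ∧ _ := by simpa using h
  all_goals
    interval_cases k <;>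
    simp only [altWord, wordProd_cons, wordProd_nil, mul_one, mul_inv_rev, mul_smul,
      simpleReflection_inv] at key ⊢ <;>
    refine key _ _ ?_ ?_ (fun z hz => by rw [hz]; simp only [R, S]; rfl) <;>
    norm_num

lemma wordProd_altWord_eq {i j : b.support} {x y : ℤ} (hx : P.pairingIn ℤ j i = -x)
    (hy : P.pairingIn ℤ i j = -y) {m : ℕ}
    (hm : (x, y, m) = (0, 0, 1) ∨ (x, y, m) = (1, 1, 2) ∨ (x, y, m) = (2, 1, 3) ∨
      (x, y, m) = (3, 1, 5)) :
    wordProd b (altWord i j (m + 1)) = wordProd b (altWord j i (m + 1)) := by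
  refine wordProd_altWord_eq_of_forall fun z => ?_
  have R (k l : ℤ) := simpleReflection_smul_comb i j hx z k l
  have S (k l : ℤ) : simpleReflection b j • (z + k • P.root i + l • P.root j) =
      z + k • P.root i + (y * k - l - P.coroot' j z) • P.root j := by
    have := simpleReflection_smul_comb j i hy z l k
    rw [add_right_comm, this, add_right_comm]
  have h0 : z = z + (0 : ℤ) • P.root i + (0 : ℤ) • P.root j := by simp
  -- Only the two pairings of $z$ enter, so the equality becomes a linear identity in $u$ and $v$.
  generalize P.coroot' i z = u at R
  generalize P.coroot' j z = v at S
  rw [h0]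
  rcases hm with h | h | h | h <;> obtain ⟨rfl, rfl, rfl⟩ : _ ∧ _ ∧ _ := by simpa using h
  all_goals
    simp only [altWord, wordProd_cons, wordProd_nil, mul_one, mul_smul, R, S]
    congr 1
    · congr 2; ring
    · congr 1; ring

end

lemma exists_pairingIn_eq {i j : b.support} (hij : i ≠ j) :
    ∃ x y : ℤ, P.pairingIn ℤ j i = -x ∧ P.pairingIn ℤ i j = -y ∧
      ((x, y) = (0, 0) ∨ (x, y) = (1, 1) ∨ (x, y) = (2, 1) ∨ (x, y) = (3, 1) ∨
        (x, y) = (1, 2) ∨ (x, y) = (1, 3)) := by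
  have hij' : (i : ι) ≠ j := fun h => hij (Subtype.ext h)
  have h1 := P.pairingIn_pairingIn_mem_set_of_isCrystal_of_isRed' i j
    (fun h => hij' (P.root.injective h)) (b.root_ne_neg_of_ne i.2 j.2 hij')
  have h2 := b.pairingIn_le_zero_of_ne hij' i.2 j.2
  have h3 := b.pairingIn_le_zero_of_ne hij'.symm j.2 i.2
  refine ⟨-P.pairingIn ℤ j i, -P.pairingIn ℤ i j, by simp, by simp, ?_⟩
  generalize P.pairingIn ℤ i j = u at *
  generalize P.pairingIn ℤ j i = v at *
  simp only [Set.mem_insert_iff, Set.mem_singleton_iff, Prod.mk.injEq] at h1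
  simp only [Prod.mk.injEq]
  omega

end RankTwo

/-! ### Demazure–Lusztig elements attached to a cocycle -/

section Hecke

set_option linter.unusedSectionVars false

variable {ι X Y : Type*} [AddCommGroup X] [AddCommGroup Y] [Module.Free ℤ X]

/-- The coefficients `c_α` of `δ_α` in a family of Demazure–Lusztig elements
`τ_α = (q - 1) / x_{-α} + c_α δ_α`. -/
structure HeckeCocycle (P : RootDatum ι X Y) where
  /-- The coefficient of `δ_α` for the root `α` of index `i`. -/
  c : ι → FracField X
  smul_c (w : P.weylGroup) (i : ι) : w • c i = c (w • i)
  -- With $d$ the constant term, this value $q+d(q-1-d)$ is exactly what the quadratic relation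
  -- requires. It is written as $1+Q+d(Q-d)$ with $Q=q-1$ to match the braid lemmas.
  c_mul_c_neg (i : ι) : c i * c (negIdx P i) =
    1 + (q X - 1) + dlConst (P.root i) * (q X - 1 - dlConst (P.root i))
  c_ne_zero (i : ι) : c i ≠ 0

variable {P : RootDatum ι X Y}

namespace HeckeCocycle

/-- The intertwiner `c_α δ_α`. -/
def intertwiner (C : HeckeCocycle P) (i : ι) : TwistedAlgebra P :=
  C.c i • δ (RootPairing.weylGroup.ofIdx P i)

/-- The Demazure–Lusztig element `τ_α = (q - 1) / x_{-α} + c_α δ_α`. -/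
def demLus (C : HeckeCocycle P) (i : ι) : TwistedAlgebra P :=
  dlConst (P.root i) • 1 + C.intertwiner i

variable (C : HeckeCocycle P)

lemma intertwiner_mul_smul (i : ι) (x : FracField X) (z : TwistedAlgebra P) :
    C.intertwiner i * (x • z) =
      (RootPairing.weylGroup.ofIdx P i • x) • (C.intertwiner i * z) := by
  rw [intertwiner, smul_mul_assoc, smul_mul_assoc, δ_mul_smul, smul_comm]

lemma intertwiner_mul_self_mul (i : ι) (z : TwistedAlgebra P) :
    C.intertwiner i * (C.intertwiner i * z) =
      (1 + (q X - 1) + dlConst (P.root i) * (q X - 1 - dlConst (P.root i))) • z := by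
  rw [← C.c_mul_c_neg]
  conv_lhs => enter [2]; rw [intertwiner, smul_mul_assoc]
  rw [intertwiner_mul_smul, C.smul_c, intertwiner, smul_mul_assoc, ← mul_assoc, δ_mul_δ,
    ofIdx_mul_self, δ_one, one_mul, smul_smul, mul_comm]
  rfl

lemma root_ne_zero (i : ι) : P.root i ≠ 0 := P.ne_zero i

/-- The quadratic relation `τ_α² = (q - 1) τ_α + q`. -/
lemma demLus_mul_self (i : ι) :
    C.demLus i * C.demLus i = (q X - 1) • C.demLus i + q X • 1 := by
  have h1 := C.intertwiner_mul_self_mul i 1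
  have h2 := C.intertwiner_mul_smul i (dlConst (P.root i)) 1
  rw [smul_dlConst, RootPairing.weylGroup.ofIdx_smul, RootPairing.Equiv.reflection_smul,
    RootPairing.reflection_apply_self,
    dlConst_neg (root_ne_zero i)] at h2
  simp only [mul_one] at h1 h2
  simp only [demLus, mul_add, add_mul, smul_mul_assoc, one_mul, h1, h2]
  module

section Coeff

variable [Fintype ι] (b : P.Base)

/-- The product of the `c_β` over `β ∈ Σ_w`. -/
def cW (w : P.weylGroup) : FracField X := ∏ j ∈ inversions b w, C.c j

lemma cW_ne_zero (w : P.weylGroup) : C.cW b w ≠ 0 :=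
  Finset.prod_ne_zero_iff.mpr fun _ _ => C.c_ne_zero _

@[simp] lemma cW_one : C.cW b 1 = 1 := by simp [cW]

variable [P.IsReduced]

lemma cW_simpleReflection_mul {i : b.support} {w : P.weylGroup} (h : b.IsPos (w⁻¹ • (i : ι))) :
    C.cW b (simpleReflection b i * w) = C.c i * simpleReflection b i • C.cW b w := by
  rw [cW, prod_inversions_simpleReflection_mul b _ h, cW, Finset.smul_prod']
  simp only [C.smul_c]

lemma intertwiner_mul_smul_δ {i : b.support} {w : P.weylGroup} (h : b.IsPos (w⁻¹ • (i : ι))) :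
    C.intertwiner i * (C.cW b w • δ w) =
      C.cW b (simpleReflection b i * w) • δ (simpleReflection b i * w) := by
  rw [intertwiner_mul_smul, intertwiner, smul_mul_assoc, δ_mul_δ, smul_smul,
    cW_simpleReflection_mul C b h, mul_comm]
  rfl

variable {b}

/-- The result depends only on $w$, which gives the braid relations of the intertwiners without any
computation. -/
lemma prod_intertwiner {l : List b.support} {w : P.weylGroup} (h : IsReducedWord b l w) :
    (l.map fun i : b.support => C.intertwiner i).prod = C.cW b w • δ w := by
  induction l generalizing w with
  | nil => rw [← h.1]; simp [δ_one]
  | cons i l ih =>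
    rw [List.map_cons, List.prod_cons, ih h.tail, intertwiner_mul_smul_δ C b h.isPos_head,
      ← wordProd_cons, h.1]

lemma root_ne_zero_of_comb {i j : b.support} (hij : i ≠ j) {k l : ℤ} (h : k ≠ 0 ∨ l ≠ 0) :
    k • P.root i + l • P.root j ≠ 0 := fun h0 => by
  have := LinearIndependent.pair_iff.mp (b.linearIndependent_pair_of_ne hij) k l h0
  omega

lemma braid_demLus_aux {i j : b.support} (hij : i ≠ j) {x y : ℤ} (hx : P.pairingIn ℤ j i = -x)
    (hy : P.pairingIn ℤ i j = -y) {m n : ℕ}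
    (hm : (x, y, m) = (0, 0, 1) ∨ (x, y, m) = (1, 1, 2) ∨ (x, y, m) = (2, 1, 3) ∨
      (x, y, m) = (3, 1, 5))
    (h : IsReducedWord b (altWord i j n) (wordProd b (altWord j i n))) :
    ((altWord i j n).map fun i : b.support => C.demLus i).prod =
      ((altWord j i n).map fun i : b.support => C.demLus i).prod := by
  by_cases hn : n = 0
  · subst hn; rfl
  obtain rfl := eq_of_isReducedWord_altWord hn h (wordProd_altWord_eq hx hy hm)
    (altWord_isPos hij hx hy hm)
  have h' : IsReducedWord b (altWord j i (m + 1)) (wordProd b (altWord j i (m + 1))) :=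
    ⟨rfl, by rw [← h.2]; simp⟩
  have hst := (C.prod_intertwiner h).trans (C.prod_intertwiner h').symm
  have R (k l : ℤ) : simpleReflection b i • dlConst (k • P.root i + l • P.root j) =
      dlConst ((x * l - k) • P.root i + l • P.root j) := by
    rw [smul_dlConst, (root_comb_smul hx hy k l).1]
  have S (k l : ℤ) : simpleReflection b j • dlConst (k • P.root i + l • P.root j) =
      dlConst (k • P.root i + (y * k - l) • P.root j) := by
    rw [smul_dlConst, (root_comb_smul hx hy k l).2]
  -- From here on only the constants at $k\alpha_i+l\alpha_j$ matter. `N` handles opposite roots,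
  -- `A` sums of roots, and `R'`, `S'` the two reflections.
  let p (k l : ℤ) : FracField X := dlConst (k • P.root i + l • P.root j)
  have N (k l : ℤ) (h : k ≠ 0 ∨ l ≠ 0) : p (-k) (-l) = (q X - 1) - p k l := by
    rw [← dlConst_neg (root_ne_zero_of_comb hij h)]
    simp only [p]; congr 1; module
  have A (k l k' l' k'' l'' : ℤ) (h : k ≠ 0 ∨ l ≠ 0) (h' : k' ≠ 0 ∨ l' ≠ 0)
      (h'' : k'' ≠ 0 ∨ l'' ≠ 0) (hk : k'' = k + k') (hl : l'' = l + l') :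
      p k'' l'' * ((q X - 1) - p k l - p k' l') + p k l * p k' l' = 0 := by
    have e : k'' • P.root i + l'' • P.root j =
        (k • P.root i + l • P.root j) + (k' • P.root i + l' • P.root j) := by
      rw [hk, hl]; module
    have h3 := root_ne_zero_of_comb hij h''
    simp only [p, e]
    rw [e] at h3
    exact dlConst_add (root_ne_zero_of_comb hij h) (root_ne_zero_of_comb hij h') h3
  let σ := MulSemiringAction.toRingHom P.weylGroup (FracField X) (simpleReflection b i)
  let θ := MulSemiringAction.toRingHom P.weylGroup (FracField X) (simpleReflection b j)
  have R' (k l k' : ℤ) (h : k' = x * l - k) : σ (p k l) = p k' l := h ▸ R k l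
  have S' (k l l' : ℤ) (h : l' = y * k - l) : θ (p k l) = p k l' := h ▸ S k l
  have hs := C.intertwiner_mul_smul (i : ι)
  have ht := C.intertwiner_mul_smul (j : ι)
  have hss := C.intertwiner_mul_self_mul (i : ι)
  have htt := C.intertwiner_mul_self_mul (j : ι)
  have hi : dlConst (P.root i) = p 1 0 := by simp [p]
  have hj : dlConst (P.root j) = p 0 1 := by simp [p]
  have hσ : σ (q X - 1) = q X - 1 := by simp [σ, smul_sub]
  have hθ : θ (q X - 1) = q X - 1 := by simp [θ, smul_sub]
  have hσi : σ (p 1 0) = (q X - 1) - p 1 0 := by rw [R' 1 0 (-1) (by ring), ← N 1 0 (by simp)]; rfl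
  have hθj : θ (p 0 1) = (q X - 1) - p 0 1 := by rw [S' 0 1 (-1) (by ring), ← N 0 1 (by simp)]; rfl
  rw [hi] at hss
  rw [hj] at htt
  rcases hm with hm | hm | hm | hm <;> obtain ⟨rfl, rfl, rfl⟩ : _ ∧ _ ∧ _ := by simpa using hm
  all_goals
    simp only [altWord, List.map_cons, List.map_nil, List.prod_cons, List.prod_nil, mul_one,
      demLus, hi, hj] at hst ⊢
  · exact braid_two (σ := σ) (θ := θ) (p 1 0) (p 0 1) hs ht hst (R' _ _ _ (by norm_num))
      (S' _ _ _ (by norm_num))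
  · exact braid_three (σ := σ) (θ := θ) (q X - 1) (p 1 0) (p 1 1) (p 0 1) hs ht hss htt hst
      hσi (R' _ _ _ (by norm_num)) (R' _ _ _ (by norm_num)) (S' _ _ _ (by norm_num))
      (S' _ _ _ (by norm_num)) hθj
      (A _ _ _ _ _ _ (by simp) (by simp) (by simp) (by norm_num) (by norm_num))
  · exact braid_four (σ := σ) (θ := θ) (q X - 1) (p 1 0) (p 2 1) (p 1 1) (p 0 1) hs ht hss htt hst
      hσ hθ hσi (R' _ _ _ (by norm_num)) (R' _ _ _ (by norm_num)) (R' _ _ _ (by norm_num))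
      (S' _ _ _ (by norm_num)) (S' _ _ _ (by norm_num)) (S' _ _ _ (by norm_num)) hθj
      (A _ _ _ _ _ _ (by simp) (by simp) (by simp) (by norm_num) (by norm_num))
      (A _ _ _ _ _ _ (by simp) (by simp) (by simp) (by norm_num) (by norm_num))
  · exact braid_six (σ := σ) (θ := θ) (q X - 1) (p 1 0) (p 3 1) (p 2 1) (p 3 2) (p 1 1) (p 0 1)
      hs ht hss htt hst
      hσ hθ hσi (R' _ _ _ (by norm_num)) (R' _ _ _ (by norm_num)) (R' _ _ _ (by norm_num))
      (R' _ _ _ (by norm_num)) (R' _ _ _ (by norm_num))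
      (S' _ _ _ (by norm_num)) (S' _ _ _ (by norm_num)) (S' _ _ _ (by norm_num))
      (S' _ _ _ (by norm_num)) (S' _ _ _ (by norm_num)) hθj
      (A _ _ _ _ _ _ (by simp) (by simp) (by simp) (by norm_num) (by norm_num))
      (A _ _ _ _ _ _ (by simp) (by simp) (by simp) (by norm_num) (by norm_num))
      (A _ _ _ _ _ _ (by simp) (by simp) (by simp) (by norm_num) (by norm_num))
      (A _ _ _ _ _ _ (by simp) (by simp) (by simp) (by norm_num) (by norm_num))
      (A _ _ _ _ _ _ (by simp) (by simp) (by simp) (by norm_num) (by norm_num))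

/-- The braid relations between Demazure–Lusztig elements. -/
lemma braid_demLus {i j : b.support} (n : ℕ) (hij : i ≠ j)
    (h : IsReducedWord b (altWord i j n) (wordProd b (altWord j i n))) :
    ((altWord i j n).map fun i : b.support => C.demLus i).prod =
      ((altWord j i n).map fun i : b.support => C.demLus i).prod := by
  have h' : IsReducedWord b (altWord j i n) (wordProd b (altWord i j n)) :=
    ⟨h.1.symm, by rw [h.1, ← h.2]; simp⟩
  obtain ⟨x, y, hx, hy, hxy⟩ := exists_pairingIn_eq hij
  simp only [Prod.mk.injEq] at hxy
  rcases hxy with ⟨rfl, rfl⟩ | ⟨rfl, rfl⟩ | ⟨rfl, rfl⟩ | ⟨rfl, rfl⟩ | ⟨rfl, rfl⟩ | ⟨rfl, rfl⟩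
  · exact C.braid_demLus_aux hij hx hy (m := 1) (by simp) h
  · exact C.braid_demLus_aux hij hx hy (m := 2) (by simp) h
  · exact C.braid_demLus_aux hij hx hy (m := 3) (by simp) h
  · exact C.braid_demLus_aux hij hx hy (m := 5) (by simp) h
  · exact (C.braid_demLus_aux hij.symm hy hx (m := 3) (by simp) h').symm
  · exact (C.braid_demLus_aux hij.symm hy hx (m := 5) (by simp) h').symm

lemma prod_demLus_eq {l l' : List b.support} {w : P.weylGroup} (h : IsReducedWord b l w)
    (h' : IsReducedWord b l' w) : (l.map fun i : b.support => C.demLus i).prod =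
      (l'.map fun i : b.support => C.demLus i).prod :=
  prod_map_eq_of_isReducedWord (fun i : b.support => C.demLus i)
    (fun _ _ n hij h => C.braid_demLus n hij h) h h'

end Coeff

end HeckeCocycle

end Hecke

/-! ### Products, supports and inverses of the elements $\tau_w$. -/

section HeckeBasis

set_option linter.unusedSectionVars false

variable {ι X Y : Type*} [AddCommGroup X] [AddCommGroup Y] [Module.Free ℤ X]
  {P : RootDatum ι X Y}

lemma qHalf_smul (n : ℤ) (z : TwistedAlgebra P) :
    qHalf X n • z = (LaurentPolynomial.T n : CoeffRing) • z :=
  algebraMap_smul (FracField X) (LaurentPolynomial.T n : CoeffRing) z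

/-- Scalars from $Q$ are not central in $Q_W$, but powers of $q^{1/2}$ are, as they come from $R$
and are fixed by $W$. -/
lemma mul_qHalf_smul (n : ℤ) (y z : TwistedAlgebra P) : y * (qHalf X n • z) = qHalf X n • (y * z) := by
  rw [qHalf_smul, qHalf_smul, mul_smul_comm]

lemma mul_q_smul (y z : TwistedAlgebra P) : y * (q X • z) = q X • (y * z) := mul_qHalf_smul 2 y z

lemma simpleReflection_mul_inv_smul (b : P.Base) (i : b.support) (v : P.weylGroup) :
    b.IsPos ((simpleReflection b i * v)⁻¹ • (i : ι)) ↔ ¬ b.IsPos (v⁻¹ • (i : ι)) := by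
  rw [mul_inv_rev, mul_smul, simpleReflection_inv, simpleReflection_smul_self, smul_negIdx,
    isPos_negIdx]

lemma mul_simpleReflection_smul (b : P.Base) (i : b.support) (v : P.weylGroup) :
    b.IsPos ((v * simpleReflection b i) • (i : ι)) ↔ ¬ b.IsPos (v • (i : ι)) := by
  rw [mul_smul, simpleReflection_smul_self, smul_negIdx, isPos_negIdx]

namespace HeckeCocycle

variable (C : HeckeCocycle P)

lemma coeff_demLus_mul (b : P.Base) (i : b.support) (z : TwistedAlgebra P) (v : P.weylGroup) :
    (C.demLus i * z).coeff v = dlConst (P.root i) * z.coeff v +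
      C.c i * simpleReflection b i • z.coeff (simpleReflection b i * v) := by
  have : (C.intertwiner i * z).coeff v =
      C.c i * simpleReflection b i • z.coeff (simpleReflection b i * v) := by
    rw [intertwiner, smul_mul_assoc, SkewMonoidAlgebra.coeff_smul, δ, Finsupp.smul_apply,
      SkewMonoidAlgebra.coeff_single_mul, one_mul, smul_eq_mul, ofIdx_inv]
    rfl
  rw [demLus, add_mul, SkewMonoidAlgebra.coeff_add, Finsupp.add_apply, this, smul_mul_assoc,
    one_mul, SkewMonoidAlgebra.coeff_smul, Finsupp.smul_apply, smul_eq_mul]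

/-- The inverse of a Demazure–Lusztig element. -/
def demLusInv (i : ι) : TwistedAlgebra P := qHalf X (-2) • (C.demLus i - (q X - 1) • 1)

lemma qHalf_neg_two_mul_q : qHalf X (-2) * q X = 1 := by rw [q, ← qHalf_add]; simp

lemma demLusInv_mul (i : ι) : C.demLusInv i * C.demLus i = 1 := by
  rw [demLusInv, smul_mul_assoc, sub_mul, demLus_mul_self, smul_mul_assoc, one_mul,
    add_sub_cancel_left, smul_smul, qHalf_neg_two_mul_q, one_smul]

lemma mul_demLusInv (i : ι) : C.demLus i * C.demLusInv i = 1 := by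
  rw [demLusInv, mul_qHalf_smul, mul_sub, demLus_mul_self, sub_smul (q X) 1 (1 : TwistedAlgebra P),
    mul_sub, mul_q_smul, one_smul, mul_one, sub_smul, one_smul]
  rw [show q X • C.demLus i - C.demLus i + q X • (1 : TwistedAlgebra P) -
    (q X • C.demLus i - C.demLus i) = q X • 1 by abel, smul_smul, qHalf_neg_two_mul_q, one_smul]

lemma isUnit_demLus (i : ι) : IsUnit (C.demLus i) :=
  ⟨⟨_, _, C.mul_demLusInv i, C.demLusInv_mul i⟩, rfl⟩

variable [Fintype ι] [P.IsReduced] (b : P.Base)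

/-- The product of Demazure–Lusztig elements along a reduced decomposition of `w`. -/
def tau (w : P.weylGroup) : TwistedAlgebra P :=
  ((reducedWord b w).map fun i : b.support => C.demLus i).prod

variable {b}

lemma prod_demLus {l : List b.support} {w : P.weylGroup} (h : IsReducedWord b l w) :
    (l.map fun i : b.support => C.demLus i).prod = C.tau b w :=
  C.prod_demLus_eq h (isReducedWord_reducedWord b w)

@[simp] lemma tau_one : C.tau b 1 = 1 := by
  exact (C.prod_demLus (l := []) (w := 1) ⟨rfl, by simp⟩).symm

lemma demLus_mul_tau {i : b.support} {w : P.weylGroup} (h : b.IsPos (w⁻¹ • (i : ι))) :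
    C.demLus i * C.tau b w = C.tau b (simpleReflection b i * w) := by
  rw [← C.prod_demLus ((isReducedWord_reducedWord b w).cons h)]
  rfl

lemma demLus_mul_tau' {i : b.support} {w : P.weylGroup} (h : ¬ b.IsPos (w⁻¹ • (i : ι))) :
    C.demLus i * C.tau b w = (q X - 1) • C.tau b w + q X • C.tau b (simpleReflection b i * w) := by
  have h1 := C.demLus_mul_tau ((simpleReflection_mul_inv_smul b i w).mpr h)
  rw [simpleReflection_mul_cancel_left] at h1
  conv_lhs => rw [← h1]
  rw [← mul_assoc, demLus_mul_self, add_mul, smul_mul_assoc, smul_mul_assoc, one_mul, h1]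

lemma tau_mul_demLus {i : b.support} {w : P.weylGroup} (h : b.IsPos (w • (i : ι))) :
    C.tau b w * C.demLus i = C.tau b (w * simpleReflection b i) := by
  have h0 := isReducedWord_reducedWord b w
  have h1 : IsReducedWord b (reducedWord b w ++ [i]) (w * simpleReflection b i) := by
    refine ⟨by simp [h0.1], ?_⟩
    rw [length_mul_simpleReflection b h, ← h0.2]
    simp
  rw [← C.prod_demLus h1]
  simp [tau]

variable (b) in
lemma isUnit_tau (w : P.weylGroup) : IsUnit (C.tau b w) := by
  induction w using weyl_induction_left b with
  | one => simp
  | mul i w h ih => rw [← C.demLus_mul_tau h]; exact (C.isUnit_demLus i).mul ih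

/-- Left multiplication by $\tau_i$ moves the support only by $s_i$, and the lifting property keeps
it below $s_iw$. -/
lemma tau_coeff_support {w v : P.weylGroup} (h : (C.tau b w).coeff v ≠ 0) : BruhatLE b v w := by
  induction w using weyl_induction_left b generalizing v with
  | one =>
    rw [tau_one, SkewMonoidAlgebra.one_def, SkewMonoidAlgebra.coeff_single] at h
    obtain rfl : v = 1 := by
      by_contra hv
      exact h (Finsupp.single_eq_of_ne hv)
    exact .refl _
  | mul i w hi ih =>
    rw [← C.demLus_mul_tau hi, C.coeff_demLus_mul b] at h
    by_cases h1 : (C.tau b w).coeff v = 0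
    · rw [h1, mul_zero, zero_add] at h
      have h2 : (C.tau b w).coeff (simpleReflection b i * v) ≠ 0 := by
        intro h2
        simp [h2] at h
      simpa using (ih h2).simpleReflection_mul hi
    · exact (ih h1).trans (bruhatLE_simpleReflection_mul hi)

/-! ### Inverses -/

lemma demLus_mul_inverse_tau {i : b.support} {w : P.weylGroup} (h : b.IsPos (w • (i : ι))) :
    C.demLus i * Ring.inverse (C.tau b (w * simpleReflection b i)) =
      Ring.inverse (C.tau b w) := by
  have h1 : C.tau b w * (C.demLus i * Ring.inverse (C.tau b (w * simpleReflection b i))) = 1 := by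
    rw [← mul_assoc, C.tau_mul_demLus h, Ring.mul_inverse_cancel _ (C.isUnit_tau b _)]
  calc _ = Ring.inverse (C.tau b w) *
      (C.tau b w * (C.demLus i * Ring.inverse (C.tau b (w * simpleReflection b i)))) := by
        rw [← mul_assoc, Ring.inverse_mul_cancel _ (C.isUnit_tau b w), one_mul]
    _ = _ := by rw [h1, mul_one]

lemma demLus_mul_inverse_tau' {i : b.support} {w : P.weylGroup} (h : b.IsPos (w • (i : ι))) :
    C.demLus i * Ring.inverse (C.tau b w) = (q X - 1) • Ring.inverse (C.tau b w) +
      q X • Ring.inverse (C.tau b (w * simpleReflection b i)) := by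
  rw [← C.demLus_mul_inverse_tau h, ← mul_assoc, demLus_mul_self, add_mul, smul_mul_assoc,
    smul_mul_assoc, one_mul]

/-- Uses $\tau_i^{-1}=q^{-1}(\tau_i-(q-1))$ to obtain a recursion for the coefficients of the
inverses. -/
lemma inverse_tau_mul_simpleReflection {i : b.support} {w : P.weylGroup}
    (h : b.IsPos (w • (i : ι))) :
    Ring.inverse (C.tau b (w * simpleReflection b i)) =
      qHalf X (-2) • (C.demLus i * Ring.inverse (C.tau b w) -
        (q X - 1) • Ring.inverse (C.tau b w)) := by
  rw [C.demLus_mul_inverse_tau' h, add_sub_cancel_left, smul_smul, qHalf_neg_two_mul_q, one_smul]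

lemma coeff_inverse_tau_mul {i : b.support} {w : P.weylGroup} (h : b.IsPos (w • (i : ι)))
    (v : P.weylGroup) :
    (Ring.inverse (C.tau b (w * simpleReflection b i))).coeff v =
      qHalf X (-2) * (dlConst (P.root i) * (Ring.inverse (C.tau b w)).coeff v + C.c i *
        simpleReflection b i • (Ring.inverse (C.tau b w)).coeff (simpleReflection b i * v) -
        (q X - 1) * (Ring.inverse (C.tau b w)).coeff v) := by
  rw [C.inverse_tau_mul_simpleReflection h, SkewMonoidAlgebra.coeff_smul, Finsupp.smul_apply,
    SkewMonoidAlgebra.coeff_sub, Finsupp.sub_apply, C.coeff_demLus_mul b,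
    SkewMonoidAlgebra.coeff_smul, Finsupp.smul_apply, smul_eq_mul, smul_eq_mul]

lemma inverse_tau_coeff_support {w v : P.weylGroup}
    (h : (Ring.inverse (C.tau b w)).coeff v ≠ 0) : BruhatLE b v w⁻¹ := by
  induction w using weyl_induction_right b generalizing v with
  | one =>
    rw [tau_one, Ring.inverse_one, SkewMonoidAlgebra.one_def, SkewMonoidAlgebra.coeff_single] at h
    obtain rfl : v = 1 := by
      by_contra hv
      exact h (Finsupp.single_eq_of_ne hv)
    simpa using BruhatLE.refl _
  | mul i w hi ih =>
    have hi' : b.IsPos (w⁻¹⁻¹ • (i : ι)) := by simpa using hi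
    rw [mul_inv_rev, simpleReflection_inv]
    rw [C.coeff_inverse_tau_mul hi] at h
    by_cases h1 : (Ring.inverse (C.tau b w)).coeff v = 0
    · have h2 : (Ring.inverse (C.tau b w)).coeff (simpleReflection b i * v) ≠ 0 := by
        intro h2
        simp [h1, h2] at h
      simpa using (ih h2).simpleReflection_mul hi'
    · exact (ih h1).trans (bruhatLE_simpleReflection_mul hi')

/-- The top coefficient. The constant parts do not contribute, since $s_iw^{-1}$ is too long for the
support of $\tau_w^{-1}$; each letter then contributes $q^{-1}$ and one factor of $c_{w^{-1}}$. -/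
lemma inverse_tau_coeff_inv (w : P.weylGroup) :
    (Ring.inverse (C.tau b w)).coeff w⁻¹ = qHalf X (-(2 * length b w)) * C.cW b w⁻¹ := by
  induction w using weyl_induction_right b with
  | one => simp
  | mul i w hi ih =>
    have hi' : b.IsPos (w⁻¹⁻¹ • (i : ι)) := by simpa using hi
    have h0 : (Ring.inverse (C.tau b w)).coeff (simpleReflection b i * w⁻¹) = 0 := by
      by_contra h0
      have h1 := length_simpleReflection_mul b hi'
      rcases (C.inverse_tau_coeff_support h0).eq_or_length_lt with h2 | h2
      · rw [h2] at h1; omega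
      · omega
    rw [mul_inv_rev, simpleReflection_inv, C.coeff_inverse_tau_mul hi, h0,
      simpleReflection_mul_cancel_left, ih, C.cW_simpleReflection_mul b hi', smul_mul',
      smul_qHalf, length_mul_simpleReflection b hi,
      show (-(2 * ((length b w + 1 : ℕ) : ℤ))) = -2 + -(2 * (length b w : ℤ)) by push_cast; ring,
      qHalf_add]
    ring

open Classical in
/-- The elements `τ_v` and `τ_u^{-1}` are dual for the coefficient of `δ_{w₀}`. -/
lemma coeff_longest_tau_mul_inverse (v u : P.weylGroup) :
    (C.tau b v * Ring.inverse (C.tau b u)).coeff (longest b) =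
      if v * u⁻¹ = longest b then qHalf X (-(2 * length b u)) * C.cW b (longest b) else 0 := by
  induction v using weyl_induction_right b generalizing u with
  | one =>
    rw [tau_one, one_mul, one_mul]
    split_ifs with h
    · rw [← h, C.inverse_tau_coeff_inv]
    · by_contra h0
      exact h (eq_longest_of_bruhatLE b (C.inverse_tau_coeff_support h0))
  | mul i v hi ih =>
    rw [← C.tau_mul_demLus hi, mul_assoc]
    -- If $us_i$ is longer than $u$, then $\tau_i\tau_u^{-1}=(q-1)\tau_u^{-1}+q\tau_{us_i}^{-1}$.
    -- The first term drops out because $v\alpha_i$ and $u\alpha_i$ are both positive, so $v\ne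
    -- w_0u$.
    by_cases hu : b.IsPos (u • (i : ι))
    · have h1 : v * (u * simpleReflection b i)⁻¹ = v * simpleReflection b i * u⁻¹ := by
        rw [mul_inv_rev, simpleReflection_inv, mul_assoc]
      have h2 : v * u⁻¹ ≠ longest b := by
        intro h
        obtain rfl : v = longest b * u := by rw [← h]; group
        rw [mul_smul, isPos_longest_smul_iff] at hi
        exact hi hu
      have hq1 : (q X - 1) • Ring.inverse (C.tau b u) =
        q X • Ring.inverse (C.tau b u) - Ring.inverse (C.tau b u) := by rw [sub_smul, one_smul]
      rw [C.demLus_mul_inverse_tau' hu, mul_add, mul_q_smul, hq1, mul_sub, mul_q_smul,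
        SkewMonoidAlgebra.coeff_add, SkewMonoidAlgebra.coeff_sub, SkewMonoidAlgebra.coeff_smul,
        SkewMonoidAlgebra.coeff_smul]
      simp only [Finsupp.add_apply, Finsupp.sub_apply, Finsupp.smul_apply, ih, h1, if_neg h2,
        smul_eq_mul, mul_zero, sub_zero, zero_add, mul_ite]
      rw [length_mul_simpleReflection b hu, q, ← mul_assoc, ← qHalf_add,
        show (2 + -(2 * ((length b u + 1 : ℕ) : ℤ))) = -(2 * (length b u : ℤ)) by push_cast; ring]
    -- If $us_i$ is shorter, $\tau_i\tau_u^{-1}=\tau_{us_i}^{-1}$, and the sign of the image of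
    -- $\alpha_i$ rules out both equalities with $w_0$: both sides vanish.
    · have h0 := C.demLus_mul_inverse_tau ((mul_simpleReflection_smul b i u).mpr hu)
      rw [mul_assoc, simpleReflection_mul_self, mul_one] at h0
      rw [h0, ih, if_neg, if_neg]
      · intro h
        obtain h1 : v * simpleReflection b i = longest b * u := by rw [← h]; group
        have h2 := mul_simpleReflection_smul b i v
        rw [h1, mul_smul, isPos_longest_smul_iff] at h2
        tauto
      · rw [mul_inv_rev, simpleReflection_inv]
        intro h
        obtain h1 : v = longest b * (u * simpleReflection b i) := by
          rw [← h]; simp [mul_assoc, simpleReflection_mul_self]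
        rw [h1, mul_smul, isPos_longest_smul_iff, mul_simpleReflection_smul] at hi
        tauto

end HeckeCocycle

end HeckeBasis

/-! ### Root polynomials and the basis $\tau_w$. -/

section RootPolynomials

set_option linter.unusedSectionVars false

variable {ι X Y : Type*} [AddCommGroup X] [AddCommGroup Y] [Module.Free ℤ X]
  {P : RootDatum ι X Y}

/-- Left multiplication by a Demazure–Lusztig element on coordinates in the basis `τ_v`. -/
def demLusCoord (b : P.Base) (i : b.support) (k : P.weylGroup → FracField X) (v : P.weylGroup) :
    FracField X :=
  if b.IsPos (v⁻¹ • (i : ι)) then q X * k (simpleReflection b i * v)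
  else k (simpleReflection b i * v) + (q X - 1) * k v

open Classical in
/-- The coefficients of the root polynomial of a word in the basis `τ_v`. -/
def wordCoeff (b : P.Base) : List b.support → P.weylGroup → FracField X
  | [] => Pi.single 1 1
  | i :: l => fun v =>
      demLusCoord b i (fun v => simpleReflection b i • wordCoeff b l v) v -
        dlConst (P.root i) * simpleReflection b i • wordCoeff b l v

lemma smul_demLusCoord (b : P.Base) (i : b.support) (u : P.weylGroup)
    (k : P.weylGroup → FracField X) (v : P.weylGroup) :
    u • demLusCoord b i k v = demLusCoord b i (fun v => u • k v) v := by
  unfold demLusCoord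
  split_ifs <;> simp [smul_add, smul_mul', smul_sub]

lemma tmul_qHalf_smul (k : FracField X) (n : ℤ) (z : TwistedAlgebra P) :
    k ⊗ₜ[CoeffRing] (qHalf X n • z) = (qHalf X n * k) ⊗ₜ[CoeffRing] z := by
  rw [qHalf_smul, ← TensorProduct.smul_tmul, Algebra.smul_def]; rfl

lemma tmul_q_smul (k : FracField X) (z : TwistedAlgebra P) :
    k ⊗ₜ[CoeffRing] (q X • z) = (q X * k) ⊗ₜ[CoeffRing] z := tmul_qHalf_smul k 2 z

section

variable [Fintype ι] [P.IsReduced] {b : P.Base}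

lemma wordCoeff_support {l : List b.support} {w v : P.weylGroup} (h : IsReducedWord b l w)
    (hv : wordCoeff b l v ≠ 0) : BruhatLE b v w := by
  induction l generalizing w v with
  | nil =>
    classical
    obtain rfl : v = 1 := by
      by_contra h1
      exact hv (Pi.single_eq_of_ne h1 _)
    rw [← h.1]
    exact .refl _
  | cons i l ih =>
    have hp := h.isPos_head
    have hw : simpleReflection b i * wordProd b l = w := by rw [← h.1, wordProd_cons]
    rw [← hw]
    by_cases h1 : wordCoeff b l v = 0
    · have h2 : wordCoeff b l (simpleReflection b i * v) ≠ 0 := by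
        intro h2
        refine hv ?_
        simp [wordCoeff, demLusCoord, h1, h2]
      simpa using (ih h.tail h2).simpleReflection_mul hp
    · exact (ih h.tail h1).trans (bruhatLE_simpleReflection_mul hp)

end

namespace HeckeCocycle

variable (C : HeckeCocycle P) [Fintype ι] [P.IsReduced] {b : P.Base}

lemma sum_tmul_demLus_mul_tau (i : b.support) (k : P.weylGroup → FracField X) :
    ∑ v, k v ⊗ₜ[CoeffRing] (C.demLus i * C.tau b v) =
      ∑ v, demLusCoord b i k v ⊗ₜ[CoeffRing] C.tau b v := by
  classical
  let A (v : P.weylGroup) : FracField X := if b.IsPos (v⁻¹ • (i : ι)) then k v else q X * k v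
  let B (v : P.weylGroup) : FracField X :=
    if b.IsPos (v⁻¹ • (i : ι)) then 0 else (q X - 1) * k v
  have h1 (v : P.weylGroup) : k v ⊗ₜ[CoeffRing] (C.demLus i * C.tau b v) =
      A v ⊗ₜ[CoeffRing] C.tau b (simpleReflection b i * v) + B v ⊗ₜ[CoeffRing] C.tau b v := by
    by_cases h : b.IsPos (v⁻¹ • (i : ι))
    · simp [A, B, h, C.demLus_mul_tau h]
    · simp only [A, B, h, C.demLus_mul_tau' h, sub_smul, one_smul, TensorProduct.tmul_add,
        TensorProduct.tmul_sub, tmul_q_smul, sub_mul, one_mul, TensorProduct.sub_tmul, if_false]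
      abel
  have h2 (v : P.weylGroup) :
      demLusCoord b i k v = A (simpleReflection b i * v) + B v := by
    simp only [demLusCoord, A, B, simpleReflection_mul_inv_smul, ite_not]
    split_ifs <;> simp
  simp only [h1, h2, TensorProduct.add_tmul, Finset.sum_add_distrib]
  congr 1
  -- Reindexing by $v\mapsto s_iv$ collects the terms in which $\tau_i$ has moved the index.
  refine (Equiv.sum_comp (Equiv.mulLeft (simpleReflection b i)) _).symm.trans ?_
  simp

/-- The starting element $u$ must vary because the tail of the word is based at $us_i$. The
coefficients do not involve `C`, which is why one family $K$ serves both signs. -/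
lemma rootPolyFrom_eq_sum (u : P.weylGroup) (l : List b.support) :
    rootPolyFrom b C.demLus u l = ∑ v, (u • wordCoeff b l v) ⊗ₜ[CoeffRing] C.tau b v := by
  classical
  induction l generalizing u with
  | nil =>
    rw [rootPolyFrom, Finset.sum_eq_single 1]
    · simp [wordCoeff, Algebra.TensorProduct.one_def]
    · intro v _ hv
      simp [wordCoeff, Pi.single_eq_of_ne hv]
    · simp
  | cons i l ih =>
    rw [rootPolyFrom, ih, sub_mul, Finset.mul_sum, Finset.mul_sum]
    simp only [Algebra.TensorProduct.tmul_mul_tmul, one_mul]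
    rw [C.sum_tmul_demLus_mul_tau, ← Finset.sum_sub_distrib]
    refine Finset.sum_congr rfl fun v _ => ?_
    rw [← TensorProduct.sub_tmul, wordCoeff, smul_sub, smul_demLusCoord, smul_mul', smul_dlConst]
    simp only [mul_smul]
    rfl

lemma rootPoly_eq_sum (l : List b.support) :
    rootPoly b C.demLus l = ∑ v, wordCoeff b l v ⊗ₜ[CoeffRing] C.tau b v := by
  simp [rootPoly, C.rootPolyFrom_eq_sum]

/-- The multiplication map `Q ⊗ Q_W → Q_W`. -/
def contract (P : RootDatum ι X Y) :
    FracField X ⊗[CoeffRing] TwistedAlgebra P →ₗ[CoeffRing] TwistedAlgebra P :=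
  TensorProduct.lift (Algebra.lsmul CoeffRing CoeffRing (A := FracField X)
    (TwistedAlgebra P)).toLinearMap

@[simp] lemma contract_tmul (x : FracField X) (z : TwistedAlgebra P) :
    contract P (x ⊗ₜ z) = x • z := rfl

/-- Removing $d(\alpha_i)$ from $\tau_i$ leaves the intertwiner, so the recursion of the root
polynomial also builds $c_w\delta_w$. The twist of the coefficients by $s_i$ comes from moving the
intertwiner past them. -/
lemma cW_smul_δ {l : List b.support} {w : P.weylGroup} (h : IsReducedWord b l w) :
    C.cW b w • δ w = ∑ v, wordCoeff b l v • C.tau b v := by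
  classical
  induction l generalizing w with
  | nil =>
    obtain rfl : w = 1 := by rw [← h.1, wordProd_nil]
    rw [Finset.sum_eq_single 1]
    · simp [wordCoeff, δ_one]
    · intro v _ hv
      simp [wordCoeff, Pi.single_eq_of_ne hv]
    · simp
  | cons i l ih =>
    have hw : simpleReflection b i * wordProd b l = w := by rw [← h.1, wordProd_cons]
    have h1 := congrArg (contract P) (C.sum_tmul_demLus_mul_tau i
      fun v => simpleReflection b i • wordCoeff b l v)
    simp only [map_sum, contract_tmul] at h1
    rw [← hw, ← C.intertwiner_mul_smul_δ b h.isPos_head, ih h.tail, Finset.mul_sum]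
    simp only [intertwiner_mul_smul, wordCoeff, sub_smul, Finset.sum_sub_distrib]
    rw [← h1, ← Finset.sum_sub_distrib]
    refine Finset.sum_congr rfl fun v _ => ?_
    rw [demLus, add_mul, smul_mul_assoc, one_mul, smul_add, mul_comm, mul_smul]
    simp [simpleReflection]

/-- As $c_w\ne0$, the preceding expansion can be solved for each $\delta_w$; spanning by $|W|$
elements then suffices for a basis. -/
lemma span_tau : ⊤ ≤ Submodule.span (FracField X) (Set.range (C.tau b)) := by
  rw [← SkewMonoidAlgebra.basisSingleOne (k := FracField X) (G := P.weylGroup).span_eq,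
    Submodule.span_le]
  rintro _ ⟨w, rfl⟩
  have h : δ w = (C.cW b w)⁻¹ • ∑ v, wordCoeff b (reducedWord b w) v • C.tau b v := by
    rw [← C.cW_smul_δ (isReducedWord_reducedWord b w), inv_smul_smul₀ (C.cW_ne_zero b w)]
  change δ w ∈ _
  rw [h]
  exact Submodule.smul_mem _ _ (Submodule.sum_mem _ fun v _ =>
    Submodule.smul_mem _ _ (Submodule.subset_span ⟨v, rfl⟩))

variable (b) in
/-- The basis `τ_w` of `Q_W`. -/
def tauBasis : Module.Basis P.weylGroup (FracField X) (TwistedAlgebra P) :=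
  basisOfTopLeSpanOfCardEqFinrank (C.tau b) C.span_tau
    (Module.finrank_eq_card_basis SkewMonoidAlgebra.basisSingleOne).symm

@[simp] lemma tauBasis_apply (w : P.weylGroup) : C.tauBasis b w = C.tau b w := by
  simp [tauBasis]

lemma repr_sum_smul_tau (k : P.weylGroup → FracField X) (v : P.weylGroup) :
    (C.tauBasis b).repr (∑ v, k v • C.tau b v) v = k v := by
  simp only [← tauBasis_apply, Module.Basis.repr_sum_self]

/-- The coefficients of the root polynomials do not depend on the reduced decomposition. -/
lemma wordCoeff_eq (C : HeckeCocycle P) {l l' : List b.support} {w : P.weylGroup} (h : IsReducedWord b l w)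
    (h' : IsReducedWord b l' w) : wordCoeff b l = wordCoeff b l' := by
  -- Both sides are coordinates of the same element $c_w\delta_w$. The cocycle does not occur in the
  -- conclusion and serves only as a tool.
  funext v
  rw [← C.repr_sum_smul_tau (wordCoeff b l), ← C.repr_sum_smul_tau (wordCoeff b l'),
    ← C.cW_smul_δ h, ← C.cW_smul_δ h']

lemma repr_δ {l : List b.support} {w : P.weylGroup} (h : IsReducedWord b l w) (v : P.weylGroup) :
    (C.tauBasis b).repr (δ w) v = wordCoeff b l v / C.cW b w := by
  rw [eq_div_iff (C.cW_ne_zero b w), mul_comm, ← smul_eq_mul, ← Finsupp.smul_apply,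
    ← map_smul, C.cW_smul_δ h, C.repr_sum_smul_tau]

/-- The coefficients of a root polynomial are determined by it. -/
lemma coeff_unique {k k' : P.weylGroup → FracField X}
    (h : ∑ v, k v ⊗ₜ[CoeffRing] C.tau b v = ∑ v, k' v ⊗ₜ[CoeffRing] C.tau b v) : k = k' := by
  have h1 := congrArg (contract P) h
  simp only [map_sum, contract_tmul] at h1
  funext v
  rw [← C.repr_sum_smul_tau k, h1, C.repr_sum_smul_tau]

end HeckeCocycle
end RootPolynomials

/-! ### The two families of Demazure–Lusztig elements and the stable bases -/

section Stable

set_option linter.unusedSectionVars false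

variable {ι X Y : Type*} [AddCommGroup X] [AddCommGroup Y] [Module.Free ℤ X]
  {P : RootDatum ι X Y}

lemma one_sub_ex_ne_zero {x : X} (hx : x ≠ 0) : 1 - ex x ≠ 0 :=
  sub_ne_zero.mpr (ex_ne_one hx).symm

lemma ex_sub_one_ne_zero {x : X} (hx : x ≠ 0) : ex x - 1 ≠ 0 :=
  sub_ne_zero.mpr (ex_ne_one hx)

/-- The coefficients `\tilde x_α / x_α` of the elements `τ⁺_α`. -/
def plusCocycle (P : RootDatum ι X Y) : HeckeCocycle P where
  c i := xTilde (P.root i) / xx (P.root i)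
  smul_c w i := by rw [smul_div_fracField, smul_xTilde, smul_xx, root_smul_index]
  c_mul_c_neg i := by
    have h0 := P.ne_zero i
    have h1 := one_sub_ex_ne_zero h0
    have h2 := ex_sub_one_ne_zero h0
    have h3 := ex_ne_zero (P.root i)
    simp only [root_negIdx, xTilde, xx, dlConst, neg_neg, ex_neg]
    have h4 : 1 - (ex (P.root i))⁻¹ = (ex (P.root i) - 1) / ex (P.root i) := by field_simp
    rw [h4]
    field_simp
    ring
  c_ne_zero i := div_ne_zero (xTilde_ne_zero _) (xx_ne_zero (P.ne_zero i))

/-- The coefficients `\hat x_α / x_{-α}` of the elements `τ⁻_α`. -/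
def minusCocycle (P : RootDatum ι X Y) : HeckeCocycle P where
  c i := xHat (P.root i) / xx (-P.root i)
  smul_c w i := by rw [smul_div_fracField, smul_xHat, smul_xx, smul_neg, root_smul_index]
  c_mul_c_neg i := by
    have h0 := P.ne_zero i
    have h1 := one_sub_ex_ne_zero h0
    have h2 := ex_sub_one_ne_zero h0
    have h3 := ex_ne_zero (P.root i)
    simp only [root_negIdx, xHat, xx, dlConst, neg_neg, ex_neg]
    have h4 : 1 - (ex (P.root i))⁻¹ = (ex (P.root i) - 1) / ex (P.root i) := by field_simp
    rw [h4]
    field_simp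
    ring
  c_ne_zero i := div_ne_zero (xHat_ne_zero _) (xx_ne_zero (neg_ne_zero.mpr (P.ne_zero i)))

/-- The constant term is $\frac{q-e^\alpha}{1-e^\alpha}-1=\frac{q-1}{1-e^\alpha}$. -/
lemma simpleTauPlus_eq : simpleTauPlus P = (plusCocycle P).demLus := by
  funext i
  have h1 := one_sub_ex_ne_zero (P.ne_zero i)
  have h2 : dlConst (P.root i) = xTilde (P.root i) * (xx (-P.root i))⁻¹ - 1 := by
    simp only [dlConst, xTilde, xx, neg_neg]
    field_simp
    ring
  rw [simpleTauPlus, pushPull, HeckeCocycle.demLus, HeckeCocycle.intertwiner, h2,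
    show (plusCocycle P).c i = xTilde (P.root i) * (xx (P.root i))⁻¹ from div_eq_mul_inv _ _,
    smul_add, smul_smul, smul_smul, sub_smul, one_smul]
  abel

/-- The constant term $\frac{1-qe^{-\alpha}}{1-e^{-\alpha}}-1$ again equals
$\frac{q-1}{1-e^\alpha}$. -/
lemma simpleTauMinus_eq : simpleTauMinus P = (minusCocycle P).demLus := by
  funext i
  have h1 := one_sub_ex_ne_zero (P.ne_zero i)
  have h3 := ex_sub_one_ne_zero (P.ne_zero i)
  have h4 := ex_ne_zero (P.root i)
  have h2 : dlConst (P.root i) = xHat (P.root i) * (xx (P.root i))⁻¹ - 1 := by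
    simp only [dlConst, xHat, xx, neg_neg, ex_neg]
    have h4 : 1 - (ex (P.root i))⁻¹ = (ex (P.root i) - 1) / ex (P.root i) := by field_simp
    rw [h4]
    field_simp
    ring
  rw [simpleTauMinus, pushPullNeg, HeckeCocycle.demLus, HeckeCocycle.intertwiner, h2,
    show (minusCocycle P).c i = xHat (P.root i) * (xx (-P.root i))⁻¹ from div_eq_mul_inv _ _,
    smul_add, smul_smul, smul_smul, sub_smul, one_smul]
  abel

lemma dual_eq_sum [Finite ι] [Fintype P.weylGroup] (g : DualAlgebra P) :
    g = ∑ v, g (δ v) • f v := by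
  classical
  refine SkewMonoidAlgebra.basisSingleOne.ext fun u => ?_
  have h (v : P.weylGroup) : f v (SkewMonoidAlgebra.basisSingleOne u) =
      if v = u then (1 : FracField X) else 0 := by
    simp [f, Finsupp.single_apply, eq_comm]
  simp only [LinearMap.sum_apply, LinearMap.smul_apply, h, smul_eq_mul, mul_ite, mul_one,
    mul_zero, Finset.sum_ite_eq', Finset.mem_univ, if_true]
  rfl

lemma f_apply (w : P.weylGroup) (z : TwistedAlgebra P) : f w z = z.coeff w := rfl

lemma bullet_apply (z z' : TwistedAlgebra P) (g : DualAlgebra P) :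
    bullet z g z' = g (z' * z) := rfl

lemma coeff_δ_mul (v u : P.weylGroup) (z : TwistedAlgebra P) :
    (δ v * z).coeff u = v • z.coeff (v⁻¹ * u) := by
  rw [δ, SkewMonoidAlgebra.coeff_single_mul, one_mul]

variable [Fintype ι] [P.IsReduced] (b : P.Base)

lemma tauPlus_eq : tauPlus b = (plusCocycle P).tau b := by
  funext w; rw [tauPlus, simpleTauPlus_eq]; rfl

lemma tauMinus_eq : tauMinus b = (minusCocycle P).tau b := by
  funext w; rw [tauMinus, simpleTauMinus_eq]; rfl

/-- A linear form whose values at `δ_v` vanish outside of a set is a sum over this set. -/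
lemma dual_eq_sum_filter (g : DualAlgebra P) (p : P.weylGroup → Prop) [DecidablePred p]
    (c : P.weylGroup → FracField X) (h : ∀ v, p v → g (δ v) = c v)
    (h0 : ∀ v, ¬ p v → g (δ v) = 0) : g = ∑ v with p v, c v • f v := by
  conv_lhs => rw [dual_eq_sum g]
  rw [Finset.sum_filter]
  refine Finset.sum_congr rfl fun v _ => ?_
  split_ifs with hv
  · rw [h v hv]
  · rw [h0 v hv, zero_smul]

/-! ### The elements `St⁺` -/

lemma StPlus_apply_δ (w v : P.weylGroup) :
    StPlus b w (δ v) = v • aPlus b w⁻¹ v⁻¹ * xNegW b (longest b) := by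
  rw [StPlus, bullet_apply, pt, LinearMap.smul_apply, f_apply, coeff_δ_mul, mul_one, smul_eq_mul,
    mul_comm, aPlus]

lemma aPlus_eq_zero {w v : P.weylGroup} (h : ¬ BruhatLE b v w) : aPlus b w⁻¹ v⁻¹ = 0 := by
  by_contra h0
  rw [aPlus, tauPlus_eq] at h0
  exact h (bruhatLE_inv_iff.mp ((plusCocycle P).tau_coeff_support h0))

lemma xNegW_longest : xNegW b (longest b) = ∏ j with b.IsPos j, (1 - ex (P.root j)) := by
  rw [xNegW, inversions_longest]
  simp [xx]

/-! ### The elements `St⁻` -/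

lemma cW_minus (w : P.weylGroup) : (minusCocycle P).cW b w = xHatW b w / xNegW b w :=
  Finset.prod_div_distrib _ _

lemma xNegW_ne_zero (w : P.weylGroup) : xNegW b w ≠ 0 :=
  Finset.prod_ne_zero_iff.mpr fun j _ => xx_ne_zero (neg_ne_zero.mpr (P.ne_zero j))

lemma xHatW_ne_zero (w : P.weylGroup) : xHatW b w ≠ 0 :=
  Finset.prod_ne_zero_iff.mpr fun _ _ => xHat_ne_zero _

/-- Tested on the basis $\tau^-_v$: the value of $\mathrm{St}^-_w$ is $x_{-w_0}$ times the
$\delta_{w_0}$-coefficient of $\tau^-_v(\tau^-_{w_0w})^{-1}$, nonzero only for $v=w$. The factor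
$x_{-w_0}$ cancels the denominator of $c_{w_0}=\hat x_{w_0}/x_{-w_0}$. -/
lemma qW_smul_StMinus (w : P.weylGroup) :
    qW b (longest b * w) • StMinus b w =
      xHatW b (longest b) • ((minusCocycle P).tauBasis b).coord w := by
  classical
  refine ((minusCocycle P).tauBasis b).ext fun v => ?_
  have h0 : v * (longest b * w)⁻¹ = longest b ↔ v = w := by
    rw [mul_inv_eq_iff_eq_mul, ← mul_assoc, longest_mul_self, one_mul]
  rw [LinearMap.smul_apply, LinearMap.smul_apply, Module.Basis.coord_apply,
    Module.Basis.repr_self, HeckeCocycle.tauBasis_apply, StMinus, bullet_apply, pt,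
    LinearMap.smul_apply, f_apply, tauMinus_eq, HeckeCocycle.coeff_longest_tau_mul_inverse,
    Finsupp.single_apply, cW_minus, qW, q_pow]
  simp only [h0, smul_eq_mul]
  split_ifs
  · have h1 := xNegW_ne_zero b (longest b)
    have h2 : qHalf X (2 * (length b (longest b * w) : ℤ)) *
      qHalf X (-(2 * (length b (longest b * w) : ℤ))) = 1 := by rw [← qHalf_add]; simp
    field_simp
    linear_combination xHatW b (longest b) * h2
  · simp

/-- The root polynomial coefficients `K^τ_{v,w}`. -/
def rootPolyCoeff (v w : P.weylGroup) : FracField X := wordCoeff b (reducedWord b w) v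

lemma rootPolyCoeff_eq_zero {v w : P.weylGroup} (h : ¬ BruhatLE b v w) :
    rootPolyCoeff b v w = 0 := by
  by_contra h0
  exact h (wordCoeff_support (isReducedWord_reducedWord b w) h0)

lemma isRootPolyCoeff_rootPolyCoeff : IsRootPolyCoeff b (rootPolyCoeff b) := by
  refine ⟨fun w l h => ?_, fun v w h => rootPolyCoeff_eq_zero b h⟩
  simp only [rootPolyCoeff, (plusCocycle P).wordCoeff_eq (isReducedWord_reducedWord b w) h]
  rw [simpleTauPlus_eq, simpleTauMinus_eq, tauPlus_eq, tauMinus_eq]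
  exact ⟨HeckeCocycle.rootPoly_eq_sum _ l, HeckeCocycle.rootPoly_eq_sum _ l⟩

variable {b} in
lemma IsRootPolyCoeff.eq {K K' : P.weylGroup → P.weylGroup → FracField X}
    (h : IsRootPolyCoeff b K) (h' : IsRootPolyCoeff b K') : K = K' := by
  funext v w
  -- One reduced word and the sign $-$ already determine the coefficients.
  have h1 := (h.1 w _ (isReducedWord_reducedWord b w)).2
  have h2 := (h'.1 w _ (isReducedWord_reducedWord b w)).2
  rw [h1, tauMinus_eq] at h2
  exact congrFun ((minusCocycle P).coeff_unique (k := fun v => K v w) (k' := fun v => K' v w) h2) v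

lemma repr_δ_minus (w v : P.weylGroup) : ((minusCocycle P).tauBasis b).repr (δ v) w =
    xNegW b v / xHatW b v * rootPolyCoeff b w v := by
  rw [HeckeCocycle.repr_δ _ (isReducedWord_reducedWord b v), cW_minus, rootPolyCoeff, div_div_eq_mul_div]
  ring

/-- The bijection $j\mapsto v\cdot j$ carries $\Sigma_{v^{-1}w_0}$ onto the positive roots that
$v^{-1}$ keeps positive. -/
lemma smul_xHatW_inv_mul_longest (v : P.weylGroup) : v • xHatW b (v⁻¹ * longest b) =
    ∏ j with b.IsPos j ∧ b.IsPos (v⁻¹ • j), (1 - q X * ex (-P.root j)) := by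
  rw [xHatW, Finset.smul_prod']
  refine Finset.prod_bij (fun j _ => v • j) (fun j hj => ?_) (fun j _ k _ h => ?_)
    (fun j hj => ?_) (fun j _ => ?_)
  · rw [mem_inversions, mul_inv_rev, inv_inv, mul_smul, longest_inv, isPos_longest_smul_iff,
      not_not] at hj
    simpa using hj.symm
  · exact MulAction.injective v h
  · refine ⟨v⁻¹ • j, ?_, smul_inv_smul v j⟩
    rw [mem_inversions, mul_inv_rev, inv_inv, mul_smul, longest_inv, isPos_longest_smul_iff,
      not_not, smul_inv_smul]
    simpa using (Finset.mem_filter.mp hj).2.symm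
  · rw [smul_xHat, ← root_smul_index]
    rfl

/-- The positive roots are split according to the sign of their image under $v^{-1}$. -/
lemma xHatW_longest (v : P.weylGroup) :
    xHatW b (longest b) = v • xHatW b (v⁻¹ * longest b) * xHatW b v := by
  rw [smul_xHatW_inv_mul_longest, xHatW, inversions_longest, xHatW, inversions,
    ← Finset.prod_filter_mul_prod_filter_not _ (fun j => b.IsPos (v⁻¹ • j)), Finset.filter_filter,
    Finset.filter_filter]
  rfl

lemma qW_smul_StMinus_apply_δ (w v : P.weylGroup) :
    (qW b (longest b * w) • StMinus b w) (δ v) =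
      v • xHatW b (v⁻¹ * longest b) * xNegW b v * rootPolyCoeff b w v := by
  have h := xHatW_ne_zero b v
  rw [qW_smul_StMinus, LinearMap.smul_apply, Module.Basis.coord_apply, repr_δ_minus,
    xHatW_longest b v, smul_eq_mul]
  field_simp

/-- Since $\ell(w_0)=\ell(w_0w)+\ell(w)$, the normalisation $q_{w_0}q_w^{-1/2}$ equals
$q_w^{1/2}q_{w_0w}$. -/
lemma stabMinus_eq (w : P.weylGroup) : stabMinus b w =
    qHalf X (length b w) • (qW b (longest b * w) • StMinus b w) := by
  rw [stabMinus, smul_smul, qW, qW, q_pow, q_pow, ← qHalf_add, ← qHalf_add,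
    ← length_longest_mul_add b w]
  congr 2
  push_cast
  ring

end Stable

end StableBasis

end

/-! ### The theorem, assembled for the two cocycles. -/

open StableBasis in
theorem theorem7p4 {ι X Y : Type*} [Fintype ι] [AddCommGroup X] [AddCommGroup Y]
    [Module.Free ℤ X] [Module.Finite ℤ X] (P : RootDatum ι X Y) [P.IsReduced] (b : P.Base) :
    -- `τ^±_w` does not depend on the reduced decomposition
    (∀ w l, IsReducedWord b l w →
      (l.map fun i : b.support => simpleTauPlus P i).prod = tauPlus b w ∧
      (l.map fun i : b.support => simpleTauMinus P i).prod = tauMinus b w) ∧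
    -- `τ^-_w` is invertible in `Q_W`
    (∀ w, IsUnit (tauMinus b w)) ∧
    -- the formula for `St^+`
    (∀ w, StPlus b w =
      ∑ v with BruhatLE b v w, (v • aPlus b w⁻¹ v⁻¹ * xNegW b (longest b)) • f v) ∧
    (∀ w v, restrict (stabPlus b w) v =
      qHalf X (-(length b w : ℤ)) * (v • aPlus b w⁻¹ v⁻¹) *
        ∏ j with b.IsPos j, (1 - ex (P.root j))) ∧
    -- the formulas for `St^-`, in terms of the dual basis of `τ^-` and of the coefficients `K^τ`
    ∃ B : Module.Basis P.weylGroup (FracField X) (TwistedAlgebra P),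
      (∀ w, B w = tauMinus b w) ∧
      ∃ K : P.weylGroup → P.weylGroup → FracField X,
        IsRootPolyCoeff b K ∧ (∀ K', IsRootPolyCoeff b K' → K' = K) ∧
        (∀ w,
          qW b (longest b * w) • StMinus b w = xHatW b (longest b) • B.coord w ∧
          qW b (longest b * w) • StMinus b w =
            ∑ v with BruhatLE b w v, (xHatW b (longest b) * B.repr (δ v) w) • f v ∧
          qW b (longest b * w) • StMinus b w =
            ∑ v with BruhatLE b w v,
              (xHatW b (longest b) * xNegW b v / xHatW b v * K w v) • f v ∧
          qW b (longest b * w) • StMinus b w =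
            ∑ v with BruhatLE b w v,
              (v • xHatW b (v⁻¹ * longest b) * xNegW b v * K w v) • f v) ∧
        (∀ w v, restrict (stabMinus b w) v =
          qHalf X (length b w) * K w v *
            (∏ j with b.IsPos j ∧ b.IsPos (v⁻¹ • j), (1 - q X * ex (-P.root j))) *
            ∏ j with b.IsPos j ∧ ¬ b.IsPos (v⁻¹ • j), (1 - ex (P.root j))) := by
  refine ⟨fun w l h => ⟨?_, ?_⟩, fun w => ?_, fun w => ?_, fun w v => ?_,
    (minusCocycle P).tauBasis b, fun w => ?_, rootPolyCoeff b, isRootPolyCoeff_rootPolyCoeff b,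
    fun K' h => h.eq (isRootPolyCoeff_rootPolyCoeff b), fun w => ?_, fun w v => ?_⟩
  · rw [simpleTauPlus_eq, tauPlus_eq, (plusCocycle P).prod_demLus h]
  · rw [simpleTauMinus_eq, tauMinus_eq, (minusCocycle P).prod_demLus h]
  · rw [tauMinus_eq]
    exact (minusCocycle P).isUnit_tau b w
  · refine dual_eq_sum_filter _ _ _ (fun v _ => StPlus_apply_δ b w v) fun v hv => ?_
    rw [StPlus_apply_δ, aPlus_eq_zero b hv, smul_zero, zero_mul]
  · rw [restrict, stabPlus, LinearMap.smul_apply, StPlus_apply_δ, xNegW_longest, smul_eq_mul,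
      mul_assoc]
  · rw [tauMinus_eq, HeckeCocycle.tauBasis_apply]
  -- The vanishing of $K_{w,v}$ off $w\le v$ truncates all three sums at once, since they are
  -- expansions of the same functional.
  · have h0 (v : P.weylGroup) (hv : ¬ BruhatLE b w v) :
        (qW b (longest b * w) • StMinus b w) (δ v) = 0 := by
      rw [qW_smul_StMinus_apply_δ, rootPolyCoeff_eq_zero b hv, mul_zero]
    refine ⟨qW_smul_StMinus b w, dual_eq_sum_filter _ _ _ (fun v _ => ?_) h0,
      dual_eq_sum_filter _ _ _ (fun v _ => ?_) h0,
      dual_eq_sum_filter _ _ _ (fun v _ => qW_smul_StMinus_apply_δ b w v) h0⟩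
    · rw [qW_smul_StMinus]
      rfl
    · rw [qW_smul_StMinus, LinearMap.smul_apply, Module.Basis.coord_apply, repr_δ_minus,
        smul_eq_mul]
      ring
  · rw [restrict, stabMinus_eq, LinearMap.smul_apply, qW_smul_StMinus_apply_δ,
      smul_xHatW_inv_mul_longest, xNegW, inversions, smul_eq_mul]
    simp only [xx, neg_neg]
    ring
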